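/- Fix integers $k,N\ge 1$. Partition diagrams are drawn in the English convention (rows numbered from north to south, columns from west to east). The content of the cell in row $i$ and column $j$ is $j-i$. A *skew shape with contents* is an equivalence class of skew shapes $\lambda/\mu$ ($\mu\subseteq\lambda$ partitions), two skew shapes being equivalent if there is a content and order preserving bijection between their diagrams. Let $\bm\beta=(\beta^{(0)},\dots,\beta^{(k-1)})$ be a $k$-tuple of skew shapes with contents. The *shifted content* of a cell $z\in\beta^{(i)}$ is $\tilde c(z)=k\,c(z)+i$, where $c(z)$ is its content. Assume that no $\beta^{(i)}$ contains a $2\times2$ square and that all shifted contents of $\bm\beta$ lie in $\{1,\dots,N\}$. Let $\mathcal U=\mathbb Z\langle u_1,\dots,u_N\rangle$ and $\mathcal U_q=\mathbb Q(q)\otimes_{\mathbb Z}\mathcal U$. Their monomials are identified with words in the alphabet $\{1,\dots,N\}$, with $u_a$ written $\mathsf a$. Let $\langle\cdot,\cdot\rangle$ be the symmetric bilinear form on $\mathcal U_q$ for which the words are an orthonormal basis, and let $I^\perp=\{f\in\mathcal U_q: \langle z,f\rangle=0\text{ for all }z\in I\}$ for a two-sided ideal $I$. Let $J_k$ be the two-sided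 ideal of $\mathcal U_q$ generated by the relations - $\mathsf{ac}=\mathsf{ca}$ for $c-a>k$, - $\mathsf{ab}=q^{-1}\mathsf{ba}$ for $0<b-a<k$, - $\mathsf w=0$ for all words $\mathsf w$ with a repeated letter. Let $W_k(\bm\beta)$ be the set of words $v$ without repeated letters that are rearrangements of the shifted contents of $\bm\beta$ and such that, for each $i$ and all cells $z,z'$ of $\beta^{(i)}$ with $z'$ immediately east or south of $z$, the letter $\tilde c(z)$ occurs before $\tilde c(z')$ in $v$. For a word $v=v_1\cdots v_n$ let $\mathrm{inv}_k(v)=|\{(i,j): i<j,\ 0<v_i-v_j<k\}|$, let $\mathrm{Des}(v)=\{i\in\{1,\dots,n-1\}: v_i>v_{i+1}\}$, and let $$Q_{\mathrm{Des}(v)}(\mathbf x)=\sum_{\substack{1\le i_1\le\cdots\le i_n\\ j\in \mathrm{Des}(v)\Rightarrow i_j<i_{j+1}}}x_{i_1}\cdots x_{i_n}$$ be Gessel's fundamental quasisymmetric function. Let $\Delta$ be the $\mathbb Q(q)$-linear map on $\mathcal U_q$ with $\Delta(v)=Q_{\mathrm{Des}(v)}(\mathbf x)$ for all words $v$. The new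 variant combinatorial LLT polynomial indexed by $\bm\beta$ is, by definition, $$\mathcal G_{\bm\beta}(\mathbf x;q)=\sum_{v\in W_k(\bm\beta)}q^{\mathrm{inv}_k(v)}Q_{\mathrm{Des}(v)}(\mathbf x),$$ and the new variant $q$-Littlewood–Richardson coefficients $\mathfrak c^\lambda_{\bm\beta}(q)\in\mathbb Q(q)$ are the coefficients of its expansion in Schur functions, $\mathcal G_{\bm\beta}(\mathbf x;q)=\sum_\lambda\mathfrak c^\lambda_{\bm\beta}(q)\,s_\lambda(\mathbf x)$. Let $e_d(\mathbf u)=\sum_{N\ge i_1>\cdots>i_d\ge1}u_{i_1}\cdots u_{i_d}$ for $d\ge1$, $e_0(\mathbf u)=1$, and $e_d(\mathbf u)=0$ for $d<0$. For a partition $\lambda$ with conjugate $\lambda'=(\lambda'_1,\dots,\lambda'_t)$, $t=\lambda_1$, let $$\mathfrak J_\lambda(\mathbf u)=\sum_{\pi\in S_t}\mathrm{sgn}(\pi)\,e_{\lambda'_1+\pi(1)-1}(\mathbf u)\,e_{\lambda'_2+\pi(2)-2}(\mathbf u)\cdots e_{\lambda'_t+\pi(t)-t}(\mathbf u).$$ **Proposition.**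 Let $f=\sum_{v\in W_k(\bm\beta)}q^{\mathrm{inv}_k(v)}\,v\in\mathcal U_q$. Then $f\in J_k^\perp$ and $\mathcal G_{\bm\beta}(\mathbf x;q)=\Delta(f)$. Moreover, the expansion of $\mathcal G_{\bm\beta}(\mathbf x;q)$ in Schur functions exists and is unique, and $\mathfrak c^\lambda_{\bm\beta}(q)=\langle\mathfrak J_\lambda(\mathbf u),f\rangle$ for every partition $\lambda$. -/

import Mathlib

noncomputable section

/-! ### Skew shapes with contents -/

/-- A skew shape `outer / inner`, where `inner ⊆ outer` are partitions (English convention: the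
cell `(i, j)` lies in row `i`, counted from north to south, and in column `j`, counted from west
to east; both indices start at `0`). -/
structure SkewShape where
  outer : YoungDiagram
  inner : YoungDiagram
  inner_le : inner ≤ outer

namespace SkewShape

/-- The diagram of a skew shape. -/
def cells (s : SkewShape) : Finset (ℕ × ℕ) := s.outer.cells \ s.inner.cells

/-- The content `j - i` of the cell `(i, j)`. -/
def content (z : ℕ × ℕ) : ℤ := (z.2 : ℤ) - (z.1 : ℤ)

/-- Two skew shapes are equivalent if there is a content and order preserving bijection between
their diagrams, which are ordered as subsets of `ℕ × ℕ`. -/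
def Equivalent (s t : SkewShape) : Prop :=
  ∃ e : s.cells ≃o t.cells, ∀ z : s.cells, content (e z : ℕ × ℕ) = content (z : ℕ × ℕ)

instance setoid : Setoid SkewShape where
  r := Equivalent
  iseqv :=
    { refl := fun s => ⟨OrderIso.refl _, fun _ => rfl⟩
      symm := by
        rintro s t ⟨e, he⟩
        refine ⟨e.symm, fun z => ?_⟩
        have h := he (e.symm z)
        rw [OrderIso.apply_symm_apply] at h
        exact h.symm
      trans := by
        rintro s t r ⟨e, he⟩ ⟨f, hf⟩
        refine ⟨e.trans f, fun z => ?_⟩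
        rw [OrderIso.trans_apply, hf, he] }

/-- The multiset of contents of the cells of a skew shape. -/
def contents (s : SkewShape) : Multiset ℤ := s.cells.val.map content

/-- The cell `z'` lies immediately east of `z`. -/
def East (z z' : ℕ × ℕ) : Prop := z'.1 = z.1 ∧ z'.2 = z.2 + 1

/-- The cell `z'` lies immediately south of `z`. -/
def South (z z' : ℕ × ℕ) : Prop := z'.1 = z.1 + 1 ∧ z'.2 = z.2

/-- The pairs `(c(z), c(z'))`, where `z, z'` are cells such that `z'` lies immediately east or
south of `z`. -/
def neighbours (s : SkewShape) : Set (ℤ × ℤ) :=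
  {p | ∃ z ∈ s.cells, ∃ z' ∈ s.cells, (East z z' ∨ South z z') ∧ p = (content z, content z')}

/-- The diagram contains a `2 × 2` square. -/
def HasSquare (s : SkewShape) : Prop :=
  ∃ i j : ℕ, (i, j) ∈ s.cells ∧ (i, j + 1) ∈ s.cells ∧ (i + 1, j) ∈ s.cells ∧
    (i + 1, j + 1) ∈ s.cells

theorem mem_cells_of_between (s : SkewShape) {a b c : ℕ × ℕ} (ha : a ∈ s.cells)
    (hc : c ∈ s.cells) (hab : a ≤ b) (hbc : b ≤ c) : b ∈ s.cells := by
  simp only [cells, Finset.mem_sdiff] at ha hc ⊢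
  exact ⟨s.outer.isLowerSet hbc hc.1, fun h => ha.2 (s.inner.isLowerSet hab h)⟩

theorem hasSquare_iff (s : SkewShape) : s.HasSquare ↔
    ∃ z z' : s.cells, z < z' ∧ content (z : ℕ × ℕ) = content (z' : ℕ × ℕ) := by
  constructor
  · rintro ⟨i, j, h1, -, -, h4⟩
    refine ⟨⟨(i, j), h1⟩, ⟨(i + 1, j + 1), h4⟩, ?_, ?_⟩
    · rw [← Subtype.coe_lt_coe, Prod.lt_iff]
      left
      constructor
      · show i < i + 1
        omega
      · show j ≤ j + 1
        omega
    · simp [content]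
  · rintro ⟨⟨⟨i, j⟩, hz⟩, ⟨⟨i', j'⟩, hz'⟩, hlt, hc⟩
    rw [← Subtype.coe_lt_coe, Prod.lt_iff] at hlt
    simp only [content] at hlt hc
    refine ⟨i, j, hz, ?_, ?_, ?_⟩ <;> refine s.mem_cells_of_between hz hz' ?_ ?_ <;>
      rw [Prod.le_def] <;> constructor <;> simp only <;> omega

theorem east_iff (s : SkewShape) (z z' : s.cells) : East (z : ℕ × ℕ) (z' : ℕ × ℕ) ↔
    z ⋖ z' ∧ content (z' : ℕ × ℕ) = content (z : ℕ × ℕ) + 1 := by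
  obtain ⟨⟨i, j⟩, hz⟩ := z
  obtain ⟨⟨i', j'⟩, hz'⟩ := z'
  constructor
  · rintro ⟨h1, h2⟩
    simp only at h1 h2
    refine ⟨⟨?_, ?_⟩, ?_⟩
    · rw [← Subtype.coe_lt_coe, Prod.lt_iff]
      simp only
      omega
    · rintro ⟨⟨a, b⟩, hy⟩ h3 h4
      rw [← Subtype.coe_lt_coe, Prod.lt_iff] at h3 h4
      simp only at h3 h4
      omega
    · simp only [content]
      omega
  · rintro ⟨⟨hlt, hcov⟩, hc⟩
    have hlt' := hlt
    rw [← Subtype.coe_lt_coe, Prod.lt_iff] at hlt'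
    simp only [content] at hlt' hc
    by_contra hne
    simp only [East] at hne
    have hy : (i, j + 1) ∈ s.cells := by
      refine s.mem_cells_of_between hz hz' ?_ ?_ <;>
        rw [Prod.le_def] <;> constructor <;> simp only <;> omega
    refine hcov (c := ⟨(i, j + 1), hy⟩) ?_ ?_ <;>
      rw [← Subtype.coe_lt_coe, Prod.lt_iff] <;> simp only <;> omega

theorem south_iff (s : SkewShape) (z z' : s.cells) : South (z : ℕ × ℕ) (z' : ℕ × ℕ) ↔
    z ⋖ z' ∧ content (z' : ℕ × ℕ) = content (z : ℕ × ℕ) - 1 := by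
  obtain ⟨⟨i, j⟩, hz⟩ := z
  obtain ⟨⟨i', j'⟩, hz'⟩ := z'
  constructor
  · rintro ⟨h1, h2⟩
    simp only at h1 h2
    refine ⟨⟨?_, ?_⟩, ?_⟩
    · rw [← Subtype.coe_lt_coe, Prod.lt_iff]
      simp only
      omega
    · rintro ⟨⟨a, b⟩, hy⟩ h3 h4
      rw [← Subtype.coe_lt_coe, Prod.lt_iff] at h3 h4
      simp only at h3 h4
      omega
    · simp only [content]
      omega
  · rintro ⟨⟨hlt, hcov⟩, hc⟩
    have hlt' := hlt
    rw [← Subtype.coe_lt_coe, Prod.lt_iff] at hlt'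
    simp only [content] at hlt' hc
    by_contra hne
    simp only [South] at hne
    have hy : (i + 1, j) ∈ s.cells := by
      refine s.mem_cells_of_between hz hz' ?_ ?_ <;>
        rw [Prod.le_def] <;> constructor <;> simp only <;> omega
    refine hcov (c := ⟨(i + 1, j), hy⟩) ?_ ?_ <;>
      rw [← Subtype.coe_lt_coe, Prod.lt_iff] <;> simp only <;> omega

theorem contents_congr (s t : SkewShape) (h : s ≈ t) : s.contents = t.contents := by
  obtain ⟨e, he⟩ := h
  have key : ∀ r : SkewShape, r.contents =
      (Finset.univ : Finset r.cells).val.map (fun z : r.cells => content z.1) := by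
    intro r
    have h2 : (Finset.univ : Finset r.cells).val.map Subtype.val = r.cells.val :=
      Multiset.attach_map_val _
    rw [contents, ← h2, Multiset.map_map]
    rfl
  rw [key s, key t, ← Finset.map_univ_equiv e.toEquiv, Finset.map_val, Multiset.map_map]
  exact Multiset.map_congr rfl fun z _ => (he z).symm

theorem neighbours_subset (s t : SkewShape) (h : s ≈ t) : s.neighbours ⊆ t.neighbours := by
  obtain ⟨e, he⟩ := h
  rintro p ⟨z, hz, z', hz', hor, rfl⟩
  refine ⟨e ⟨z, hz⟩, (e ⟨z, hz⟩).2, e ⟨z', hz'⟩, (e ⟨z', hz'⟩).2, ?_, by rw [he, he]⟩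
  rcases hor with h | h
  · left
    have h' := (s.east_iff ⟨z, hz⟩ ⟨z', hz'⟩).1 h
    exact (t.east_iff _ _).2 ⟨(apply_covBy_apply_iff e).2 h'.1, by rw [he, he]; exact h'.2⟩
  · right
    have h' := (s.south_iff ⟨z, hz⟩ ⟨z', hz'⟩).1 h
    exact (t.south_iff _ _).2 ⟨(apply_covBy_apply_iff e).2 h'.1, by rw [he, he]; exact h'.2⟩

theorem neighbours_congr (s t : SkewShape) (h : s ≈ t) : s.neighbours = t.neighbours :=
  Set.Subset.antisymm (neighbours_subset s t h) (neighbours_subset t s (Setoid.symm h))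

theorem hasSquare_of_equiv (s t : SkewShape) (h : s ≈ t) (hs : s.HasSquare) : t.HasSquare := by
  obtain ⟨e, he⟩ := h
  obtain ⟨z, z', hlt, hc⟩ := s.hasSquare_iff.1 hs
  exact t.hasSquare_iff.2 ⟨e z, e z', e.lt_iff_lt.2 hlt, by rw [he, he, hc]⟩

theorem hasSquare_congr (s t : SkewShape) (h : s ≈ t) : s.HasSquare = t.HasSquare :=
  propext ⟨hasSquare_of_equiv s t h, hasSquare_of_equiv t s (Setoid.symm h)⟩

end SkewShape

/-- A skew shape with contents: a skew shape up to content and order preserving bijections of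
diagrams. -/
def SkewShapeWithContents : Type := Quotient SkewShape.setoid

namespace SkewShapeWithContents

/-- The multiset of contents of the cells. -/
def contents (b : SkewShapeWithContents) : Multiset ℤ :=
  Quotient.lift SkewShape.contents SkewShape.contents_congr b

/-- The pairs `(c(z), c(z'))`, where `z, z'` are cells such that `z'` lies immediately east or
south of `z`. -/
def neighbours (b : SkewShapeWithContents) : Set (ℤ × ℤ) :=
  Quotient.lift SkewShape.neighbours SkewShape.neighbours_congr b

/-- The diagram contains a `2 × 2` square. -/
def HasSquare (b : SkewShapeWithContents) : Prop :=
  Quotient.lift SkewShape.HasSquare SkewShape.hasSquare_congr b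

end SkewShapeWithContents

/-! ### Words and the algebra of noncommutative polynomials -/

/-- Words in the alphabet `{1, …, N}`. The element `a : Fin N` stands for the letter `a + 1`. -/
abbrev Word (N : ℕ) : Type := FreeMonoid (Fin N)

/-- The letter in `{1, …, N}` for which an element of `Fin N` stands. -/
def letter {N : ℕ} (a : Fin N) : ℤ := (a : ℤ) + 1

/-- The free associative algebra `R⟨u_1, …, u_N⟩`, with the words as an `R`-basis. -/
abbrev NCPoly (R : Type) [CommRing R] (N : ℕ) : Type := MonoidAlgebra R (Word N)

/-- A word regarded as a monomial. -/
def monom (R : Type) [CommRing R] {N : ℕ} (w : Word N) : NCPoly R N := MonoidAlgebra.of R (Word N) w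

/-- The symmetric bilinear form for which the monomials form an orthonormal basis. -/
def wordPairing (R : Type) [CommRing R] (N : ℕ) : LinearMap.BilinForm R (NCPoly R N) :=
  LinearMap.mk₂ R (fun f g => f.coeff.sum fun w a => a * g.coeff w)
    (fun f f' g => by
      rw [MonoidAlgebra.coeff_add]
      exact Finsupp.sum_add_index' (fun _ => zero_mul _) (fun _ _ _ => add_mul _ _ _))
    (fun c f g => by
      rw [MonoidAlgebra.coeff_smul, Finsupp.sum_smul_index' (fun _ => zero_mul _),
        Finsupp.smul_sum]
      simp only [smul_eq_mul, mul_assoc])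
    (fun f g g' => by
      simp only [MonoidAlgebra.coeff_add, Finsupp.add_apply, mul_add]
      exact Finsupp.sum_add)
    (fun c f g => by
      simp only [MonoidAlgebra.coeff_smul, Finsupp.smul_apply, smul_eq_mul, Finsupp.mul_sum,
        mul_left_comm])

/-- The orthogonal complement of a two-sided ideal. -/
def orthogonalComplement {R : Type} [CommRing R] {N : ℕ} (I : TwoSidedIdeal (NCPoly R N)) :
    Submodule R (NCPoly R N) where
  carrier := {f | ∀ z ∈ I, wordPairing R N z f = 0}
  add_mem' := fun {f g} hf hg z hz => by rw [map_add, hf z hz, hg z hz, add_zero]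
  zero_mem' := fun _ _ => map_zero _
  smul_mem' := fun c f hf z hz => by rw [map_smul, hf z hz, smul_zero]

/-- The noncommutative elementary symmetric function `e_d(u)`: the sum of the monomials
`u_{i_1} ⋯ u_{i_d}` over all `i_1 > ⋯ > i_d`; it is `0` for `d < 0`. -/
def ncElem (R : Type) [CommRing R] (N : ℕ) (d : ℤ) : NCPoly R N :=
  if d < 0 then 0
  else ∑ S ∈ Finset.powersetCard d.toNat (Finset.univ : Finset (Fin N)),
    monom R (FreeMonoid.ofList (S.sort (· ≥ ·)))

/-- The noncommutative Schur function `𝔍_λ(u)`, by the Jacobi–Trudi formula in terms of the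
column lengths of `λ`. The factors are multiplied from left to right. -/
def ncSchur (R : Type) [CommRing R] (N : ℕ) (lam : YoungDiagram) : NCPoly R N :=
  ∑ p : Equiv.Perm (Fin (lam.rowLen 0)), (Equiv.Perm.sign p : ℤ) •
    (List.ofFn fun i : Fin (lam.rowLen 0) =>
      ncElem R N ((lam.colLen (i : ℕ) : ℤ) + ((p i : ℕ) : ℤ) - ((i : ℕ) : ℤ))).prod

/-! ### Quasisymmetric functions and Schur functions

Functions in the commuting variables `x_1, x_2, …` are power series in variables indexed by `ℕ`. -/

/-- The positions of the descents of a word (the positions of its letters are counted from `0`). -/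
def descents {N : ℕ} (w : Word N) : Set ℕ :=
  {i | ∃ h : i + 1 < w.toList.length, w.toList[i + 1] < w.toList[i]}

/-- Gessel's fundamental quasisymmetric function of degree `n` for a set `D` of descents (counted
from `0`): the sum of `x_{i_1} ⋯ x_{i_n}` over all weakly increasing `i_1, …, i_n` that increase
strictly at the elements of `D`. -/
def fundamentalQSym (R : Type) [CommRing R] (n : ℕ) (D : Set ℕ) : MvPowerSeries ℕ R :=
  fun m => (Set.ncard {i : Fin n → ℕ | Monotone i ∧
    (∀ j j' : Fin n, (j' : ℕ) = (j : ℕ) + 1 → (j : ℕ) ∈ D → i j < i j') ∧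
    ∑ j, Finsupp.single (i j) 1 = m} : R)

/-- The function `Q_{Des(w)}(x)` of a word `w`. -/
def wordQSym (R : Type) [CommRing R] {N : ℕ} (w : Word N) : MvPowerSeries ℕ R :=
  fundamentalQSym R w.toList.length (descents w)

/-- The linear map `Δ` that sends a word `w` to `Q_{Des(w)}(x)`. -/
def genFun (R : Type) [CommRing R] (N : ℕ) : NCPoly R N →ₗ[R] MvPowerSeries ℕ R :=
  (Finsupp.linearCombination R (fun w : Word N => wordQSym R w)).comp
    (MonoidAlgebra.coeffLinearEquiv R).toLinearMap

/-- The Schur function `s_λ(x)`, the sum of `x^T` over all semistandard Young tableaux `T` of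
shape `λ`. -/
def schurFun (R : Type) [CommRing R] (lam : YoungDiagram) : MvPowerSeries ℕ R :=
  fun m => (Set.ncard {T : SemistandardYoungTableau lam |
    ∑ c ∈ lam.cells, Finsupp.single (T c.1 c.2) 1 = m} : R)

/-! ### LLT polynomials -/

/-- The field `ℚ(q)`. -/
abbrev QField : Type := RatFunc ℚ

/-- The indeterminate `q`. -/
def qq : QField := RatFunc.X

/-- The shifted content `k c + i` of a cell of content `c` in the `i`-th skew shape. -/
def shifted (k : ℕ) (i : Fin k) (c : ℤ) : ℤ := (k : ℤ) * c + ((i : ℕ) : ℤ)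

/-- The multiset of shifted contents of a `k`-tuple of skew shapes with contents. -/
def shiftedContents {k : ℕ} (β : Fin k → SkewShapeWithContents) : Multiset ℤ :=
  ∑ i : Fin k, (β i).contents.map (shifted k i)

/-- No `β^{(i)}` contains a `2 × 2` square, and the shifted contents of `β` lie in
`{1, …, N}`. -/
def Admissible (N : ℕ) {k : ℕ} (β : Fin k → SkewShapeWithContents) : Prop :=
  (∀ i, ¬ (β i).HasSquare) ∧ ∀ c ∈ shiftedContents β, 1 ≤ c ∧ c ≤ (N : ℤ)

/-- The letter `a` occurs before the letter `b` in the word `v`. -/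
def OccursBefore {N : ℕ} (v : Word N) (a b : ℤ) : Prop :=
  ∃ p r : Fin v.toList.length, p < r ∧ letter (v.toList.get p) = a ∧ letter (v.toList.get r) = b

/-- The set of words `v` without repeated letters that are rearrangements of the shifted contents
of `β`, such that for cells `z, z'` of one and the same `β^{(i)}`, where `z'` lies immediately
east or south of `z`, the shifted content of `z` occurs before that of `z'`. -/
def lltWordSet (N : ℕ) {k : ℕ} (β : Fin k → SkewShapeWithContents) : Set (Word N) :=
  {v | v.toList.Nodup ∧ ((v.toList.map letter : List ℤ) : Multiset ℤ) = shiftedContents β ∧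
    ∀ i, ∀ p ∈ (β i).neighbours, OccursBefore v (shifted k i p.1) (shifted k i p.2)}

theorem lltWordSet_finite (N : ℕ) {k : ℕ} (β : Fin k → SkewShapeWithContents) :
    (lltWordSet N β).Finite := by
  refine (List.finite_length_eq (Fin N) (Multiset.card (shiftedContents β))).subset ?_
  intro v hv
  have h := hv.2.1
  show (FreeMonoid.toList v).length = _
  rw [← h, Multiset.coe_card, List.length_map]

/-- The words of `lltWordSet`, as a finite set. -/
def lltWords (N : ℕ) {k : ℕ} (β : Fin k → SkewShapeWithContents) : Finset (Word N) :=
  (lltWordSet_finite N β).toFinset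

/-- The number of pairs of positions `i < j` with `0 < v_i - v_j < k`. -/
def kInv (k : ℕ) {N : ℕ} (v : Word N) : ℕ :=
  (Finset.univ.filter fun p : Fin v.toList.length × Fin v.toList.length =>
    p.1 < p.2 ∧ 0 < letter (v.toList.get p.1) - letter (v.toList.get p.2) ∧
      letter (v.toList.get p.1) - letter (v.toList.get p.2) < (k : ℤ)).card

/-- The new variant combinatorial LLT polynomial indexed by `β`. -/
def lltPoly (N : ℕ) {k : ℕ} (β : Fin k → SkewShapeWithContents) : MvPowerSeries ℕ QField :=
  ∑ v ∈ lltWords N β, qq ^ kInv k v • wordQSym QField v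

/-- The element `f = ∑ q^{inv_k(v)} v` of `ℚ(q)⟨u_1, …, u_N⟩`. -/
def lltElement (N : ℕ) {k : ℕ} (β : Fin k → SkewShapeWithContents) : NCPoly QField N :=
  ∑ v ∈ lltWords N β, qq ^ kInv k v • monom QField v

/-- The family `c` consists of the coefficients of a Schur expansion of the LLT polynomial indexed
by `β`. -/
def IsQLRFamily (N : ℕ) {k : ℕ} (β : Fin k → SkewShapeWithContents)
    (c : YoungDiagram →₀ QField) : Prop :=
  lltPoly N β = c.sum fun lam a => a • schurFun QField lam

/-! ### The ideal of Lam's relations -/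

/-- The variable `u_a`. -/
def uVar {N : ℕ} (a : Fin N) : NCPoly QField N := monom QField (FreeMonoid.of a)

/-- The generators of the ideal: `u_a u_c - u_c u_a` for `c - a > k`, then
`u_a u_b - q⁻¹ u_b u_a` for `0 < b - a < k`, and the words with a repeated letter. -/
def lamRelations (k N : ℕ) : Set (NCPoly QField N) :=
  {x | ∃ a c : Fin N, letter c - letter a > (k : ℤ) ∧ x = uVar a * uVar c - uVar c * uVar a} ∪
  {x | ∃ a b : Fin N, 0 < letter b - letter a ∧ letter b - letter a < (k : ℤ) ∧
    x = uVar a * uVar b - qq⁻¹ • (uVar b * uVar a)} ∪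
  {x | ∃ w : Word N, ¬ w.toList.Nodup ∧ x = monom QField w}

/-- The two-sided ideal of `ℚ(q)⟨u_1, …, u_N⟩` generated by the relations. -/
def lamIdeal (k N : ℕ) : TwoSidedIdeal (NCPoly QField N) := TwoSidedIdeal.span (lamRelations k N)

end

/-!
Modulo Lam's relations the noncommutative elementary functions `e_d(u)` commute with one another,
and since `u_a p u_a = 0` for all `p`, the sums `h_d(u)` of strictly increasing products are inverse
to them in the sense of generating functions. So the `e_d(u)` generate a commutative ring, in which
the dual Jacobi–Trudi determinants `𝔍_μ(u)` obey the Pieri rule and `∏ i, h_{m_i}(u)` equals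
`∑ μ, K_{μ m} 𝔍_μ(u)`, where `K_{μ m}` counts the semistandard tableaux of shape `μ` and content
`m`. For a word `v` without repeated letters the coefficient of `x^m` in `Q_{Des(v)}` is that of `v`
in `∏ i, h_{m_i}(u)`. Pairing with `f ∈ J_k^⊥` gives `Δ(f) = ∑ μ, ⟨𝔍_μ(u), f⟩ s_μ`.

The element `f` of the theorem lies in `J_k^⊥` because interchanging two adjacent letters `a < b` of
a word with `b - a ≠ k` keeps the word in `W_k(β)`, and it changes `inv_k` by `1` if `b - a < k` and
not at all if `b - a > k`.
-/

noncomputable section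

open Finset (powersetCard)
open Finset.HasAntidiagonal (antidiagonal)
open YoungDiagram (mem_iff_lt_colLen mem_iff_lt_rowLen)

/-! ### Noncommutative elementary and complete symmetric functions -/

section NoncommutativeSymmetric

variable {α A : Type*} [LinearOrder α]

theorem sum_powersetCard_insert {M : Type*} [AddCommMonoid M] {a : α} {S : Finset α} (ha : a ∉ S)
    (d : ℕ) (g : Finset α → M) :
    ∑ T ∈ powersetCard (d + 1) (insert a S), g T =
      ∑ T ∈ powersetCard (d + 1) S, g T + ∑ T ∈ powersetCard d S, g (insert a T) := by
  have hnotMem : ∀ {n T}, T ∈ powersetCard n S → a ∉ T := fun hT h =>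
    ha ((Finset.mem_powersetCard.1 hT).1 h)
  rw [Finset.powersetCard_succ_insert ha, Finset.sum_union, Finset.sum_image]
  · intro T hT T' hT' h
    rw [← Finset.erase_insert (hnotMem hT), ← Finset.erase_insert (hnotMem hT'), h]
  · rw [Finset.disjoint_left]
    intro T hT hT'
    obtain ⟨T', -, rfl⟩ := Finset.mem_image.1 hT'
    exact hnotMem hT (Finset.mem_insert_self _ _)

theorem sort_ge_insert {a : α} {S : Finset α} (h : ∀ b ∈ S, a < b) :
    (insert a S).sort (· ≥ ·) = S.sort (· ≥ ·) ++ [a] := by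
  have ha : a ∉ S := fun ha => lt_irrefl a (h a ha)
  refine List.Perm.eq_of_pairwise' (r := (· ≥ ·)) (Finset.pairwise_sort _ _) ?_ ?_
  · refine List.pairwise_append.2 ⟨Finset.pairwise_sort _ _, List.pairwise_singleton _ _, ?_⟩
    intro b hb c hc
    rw [List.mem_singleton.1 hc]
    exact (h b ((Finset.mem_sort _).1 hb)).le
  · refine (List.perm_ext_iff_of_nodup (Finset.sort_nodup _ _) ?_).2 fun b => by simp [or_comm]
    exact (Finset.sort_nodup _ _).append (List.nodup_singleton a) (by simpa using ha)

section Semiring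

variable [Semiring A] (u : α → A)

/-- The elementary symmetric function of degree `d` in the noncommuting elements `u a`, `a ∈ S`:
the sum of their strictly decreasing products of length `d`. -/
def ncEsymm (S : Finset α) (d : ℕ) : A :=
  ∑ T ∈ powersetCard d S, ((T.sort (· ≥ ·)).map u).prod

/-- The sum of the strictly increasing products of `d` of the noncommuting elements `u a`, `a ∈ S`.
It stands in for the complete homogeneous symmetric function, because products in which some `u a`
occurs twice vanish in the quotients under consideration. -/
def ncHsymm (S : Finset α) (d : ℕ) : A :=
  ∑ T ∈ powersetCard d S, ((T.sort (· ≤ ·)).map u).prod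

@[simp] theorem ncEsymm_zero (S : Finset α) : ncEsymm u S 0 = 1 := by simp [ncEsymm]

@[simp] theorem ncHsymm_zero (S : Finset α) : ncHsymm u S 0 = 1 := by simp [ncHsymm]

@[simp] theorem ncEsymm_empty_succ (d : ℕ) : ncEsymm u ∅ (d + 1) = 0 := by
  rw [ncEsymm, Finset.powersetCard_eq_empty.2 d.succ_pos, Finset.sum_empty]

@[simp] theorem ncHsymm_empty_succ (d : ℕ) : ncHsymm u ∅ (d + 1) = 0 := by
  rw [ncHsymm, Finset.powersetCard_eq_empty.2 d.succ_pos, Finset.sum_empty]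

theorem ncEsymm_insert {a : α} {S : Finset α} (h : ∀ b ∈ S, a < b) (d : ℕ) :
    ncEsymm u (insert a S) (d + 1) = ncEsymm u S (d + 1) + ncEsymm u S d * u a := by
  have ha : a ∉ S := fun ha => lt_irrefl a (h a ha)
  rw [ncEsymm, sum_powersetCard_insert ha, ncEsymm, ncEsymm, Finset.sum_mul]
  congr 1
  refine Finset.sum_congr rfl fun T hT => ?_
  rw [sort_ge_insert fun b hb => h b ((Finset.mem_powersetCard.1 hT).1 hb), List.map_append,
    List.prod_append, List.map_singleton, List.prod_singleton]

theorem ncHsymm_insert {a : α} {S : Finset α} (h : ∀ b ∈ S, a < b) (d : ℕ) :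
    ncHsymm u (insert a S) (d + 1) = ncHsymm u S (d + 1) + u a * ncHsymm u S d := by
  have ha : a ∉ S := fun ha => lt_irrefl a (h a ha)
  rw [ncHsymm, sum_powersetCard_insert ha, ncHsymm, ncHsymm, Finset.mul_sum]
  congr 1
  refine Finset.sum_congr rfl fun T hT => ?_
  have hTS := (Finset.mem_powersetCard.1 hT).1
  rw [Finset.sort_insert (· ≤ ·) (fun b hb => (h b (hTS hb)).le) (fun haT => ha (hTS haT)),
    List.map_cons, List.prod_cons]

theorem map_ncEsymm {B : Type*} [Semiring B] (f : A →+* B) (S : Finset α) (d : ℕ) :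
    f (ncEsymm u S d) = ncEsymm (fun a => f (u a)) S d := by
  simp only [ncEsymm, map_sum, map_list_prod, List.map_map, Function.comp_def]

theorem map_ncHsymm {B : Type*} [Semiring B] (f : A →+* B) (S : Finset α) (d : ℕ) :
    f (ncHsymm u S d) = ncHsymm (fun a => f (u a)) S d := by
  simp only [ncHsymm, map_sum, map_list_prod, List.map_map, Function.comp_def]

end Semiring

section Ring

variable [Ring A] (u : α → A)

/-- Two consequences of Lam's relations for the elements `u a` which ensure that their
noncommutative elementary symmetric functions commute. -/
structure IsLamFamily : Prop where
  mul_mul_self : ∀ a p, u a * p * u a = 0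
  commute_lie : ∀ a b m, a < b → b < m → Commute ⁅u a, u m⁆ (u b)

namespace IsLamFamily

variable {u}

theorem mul_self (hu : IsLamFamily u) (a : α) : u a * u a = 0 := by
  rw [← hu.mul_mul_self a 1, mul_one]

theorem mul_ncEsymm (hu : IsLamFamily u) {a : α} {S : Finset α} (h : ∀ b ∈ S, a < b) (d : ℕ) :
    u a * ncEsymm u S (d + 1) =
      ncEsymm u S (d + 1) * u a + ∑ m ∈ S, ncEsymm u (S.erase m) d * ⁅u a, u m⁆ := by
  induction S using Finset.induction_on_min generalizing d with
  | empty => simp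
  | insert b S hb ih =>
    have hbS : b ∉ S := fun hbS => lt_irrefl b (hb b hbS)
    have ih := ih fun c hc => h c (Finset.mem_insert_of_mem hc)
    have hab : u a * u b = u b * u a + ⁅u a, u b⁆ := by rw [Ring.lie_def]; abel
    rw [ncEsymm_insert u hb, Finset.sum_insert hbS, Finset.erase_insert hbS, mul_add, ih, add_mul]
    rcases d with _ | d
    · simp only [ncEsymm_zero, one_mul, hab]
      abel
    have hsum : ∑ m ∈ S, ncEsymm u ((insert b S).erase m) (d + 1) * ⁅u a, u m⁆ =
        ∑ m ∈ S, ncEsymm u (S.erase m) (d + 1) * ⁅u a, u m⁆ +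
          (∑ m ∈ S, ncEsymm u (S.erase m) d * ⁅u a, u m⁆) * u b := by
      rw [Finset.sum_mul, ← Finset.sum_add_distrib]
      refine Finset.sum_congr rfl fun m hm => ?_
      have hcomm := (hu.commute_lie a b m (h b (Finset.mem_insert_self b S)) (hb m hm)).eq
      rw [Finset.erase_insert_of_ne (hb m hm).ne,
        ncEsymm_insert u fun c hc => hb c (Finset.mem_of_mem_erase hc), add_mul, mul_assoc _ (u b),
        ← hcomm, mul_assoc _ _ (u b)]
    rw [hsum, ← mul_assoc (u a), ih, add_mul, mul_assoc _ (u a), hab, mul_add]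
    simp only [mul_assoc]
    abel

theorem ncEsymm_mul_mul (hu : IsLamFamily u) (m : α) (S : Finset α) (d : ℕ) (p : A) :
    ncEsymm u S d * p * u m = ncEsymm u (S.erase m) d * p * u m := by
  induction S using Finset.induction_on_min generalizing d p with
  | empty => simp
  | insert b S hb ih =>
    rcases d with _ | d
    · simp
    rw [ncEsymm_insert u hb]
    rcases eq_or_ne b m with rfl | hbm
    · have hbS : b ∉ S := fun hbS => lt_irrefl b (hb b hbS)
      rw [Finset.erase_insert hbS, add_mul, add_mul, mul_assoc _ (u b) p,
        mul_assoc _ (u b * p) (u b), hu.mul_mul_self, mul_zero, add_zero]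
    · rw [Finset.erase_insert_of_ne hbm,
        ncEsymm_insert u fun c hc => hb c (Finset.mem_of_mem_erase hc), add_mul, add_mul, add_mul,
        add_mul, ih, mul_assoc _ (u b) p, ih, mul_assoc _ (u b) p]

theorem ncEsymm_mul_mul_ncEsymm (hu : IsLamFamily u) {a : α} {S : Finset α} (h : ∀ b ∈ S, a < b)
    (i j : ℕ) :
    ncEsymm u S i * (u a * ncEsymm u S (j + 1)) = ncEsymm u S i * ncEsymm u S (j + 1) * u a +
      ∑ m ∈ S, ncEsymm u (S.erase m) i * ncEsymm u (S.erase m) j * ⁅u a, u m⁆ := by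
  rw [hu.mul_ncEsymm h, mul_add, Finset.mul_sum, mul_assoc]
  congr 1
  refine Finset.sum_congr rfl fun m _ => ?_
  have h₁ := hu.ncEsymm_mul_mul m S i (ncEsymm u (S.erase m) j * u a)
  have h₂ := hu.ncEsymm_mul_mul m S i (ncEsymm u (S.erase m) j)
  simp only [← mul_assoc] at h₁ h₂
  simp only [Ring.lie_def, mul_sub, ← mul_assoc, h₁, h₂]

theorem ncEsymm_insert_mul_ncEsymm_insert (hu : IsLamFamily u) {a : α} {S : Finset α}
    (h : ∀ b ∈ S, a < b) (i j : ℕ) :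
    ncEsymm u (insert a S) (i + 1) * ncEsymm u (insert a S) (j + 1) =
      ncEsymm u S (i + 1) * ncEsymm u S (j + 1) +
        (ncEsymm u S i * ncEsymm u S (j + 1) + ncEsymm u S (i + 1) * ncEsymm u S j) * u a +
        ∑ m ∈ S, ncEsymm u (S.erase m) i * ncEsymm u (S.erase m) j * ⁅u a, u m⁆ := by
  have hzero : u a * (ncEsymm u S j * u a) = 0 := by rw [← mul_assoc, hu.mul_mul_self]
  rw [ncEsymm_insert u h, ncEsymm_insert u h, add_mul, mul_add, mul_assoc (ncEsymm u S i), mul_add,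
    mul_add, hu.ncEsymm_mul_mul_ncEsymm h, hzero, mul_zero, add_mul, ← mul_assoc]
  abel

theorem commute_ncEsymm (hu : IsLamFamily u) (S : Finset α) (i j : ℕ) :
    Commute (ncEsymm u S i) (ncEsymm u S j) := by
  induction S using Finset.strongInduction generalizing i j with
  | H S ih =>
  rcases S.eq_empty_or_nonempty with rfl | hne
  · rcases i with _ | i <;> rcases j with _ | j <;> simp
  obtain ⟨a, S, h, rfl⟩ : ∃ a, ∃ S' : Finset α, (∀ b ∈ S', a < b) ∧ S = insert a S' :=
    ⟨S.min' hne, S.erase (S.min' hne), fun b => Finset.min'_lt_of_mem_erase_min' _ _,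
      (Finset.insert_erase (S.min'_mem hne)).symm⟩
  have hS : S ⊂ insert a S := Finset.ssubset_insert fun ha => lt_irrefl a (h a ha)
  rcases i with _ | i
  · simp
  rcases j with _ | j
  · simp
  have herase : ∀ m ∈ S, ncEsymm u (S.erase m) i * ncEsymm u (S.erase m) j * ⁅u a, u m⁆ =
      ncEsymm u (S.erase m) j * ncEsymm u (S.erase m) i * ⁅u a, u m⁆ := fun m _ => by
    rw [(ih _ ((S.erase_subset m).trans_ssubset hS) i j).eq]
  rw [commute_iff_eq, hu.ncEsymm_insert_mul_ncEsymm_insert h,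
    hu.ncEsymm_insert_mul_ncEsymm_insert h, (ih S hS (i + 1) (j + 1)).eq, (ih S hS i (j + 1)).eq,
    (ih S hS (i + 1) j).eq, Finset.sum_congr rfl herase,
    add_comm (ncEsymm u S (j + 1) * ncEsymm u S i)]

end IsLamFamily

/-- The generating function `∑ e_d t^d` of the noncommutative elementary symmetric functions. -/
def ncESeries (S : Finset α) : PowerSeries A := PowerSeries.mk (ncEsymm u S)

/-- The generating function `∑ (-1)^d h_d t^d` of the sums of strictly increasing products. -/
def ncHSeries (S : Finset α) : PowerSeries A := PowerSeries.mk fun d => (-1) ^ d * ncHsymm u S d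

@[simp] theorem ncESeries_empty : ncESeries u ∅ = 1 := by
  ext d
  rcases d with _ | d <;> simp [ncESeries, PowerSeries.coeff_one]

@[simp] theorem ncHSeries_empty : ncHSeries u ∅ = 1 := by
  ext d
  rcases d with _ | d <;> simp [ncHSeries, PowerSeries.coeff_one]

theorem ncESeries_insert {a : α} {S : Finset α} (h : ∀ b ∈ S, a < b) :
    ncESeries u (insert a S) = ncESeries u S * (1 + PowerSeries.C (u a) * PowerSeries.X) := by
  ext d
  rcases d with _ | d
  · simp [ncESeries, mul_add, ← mul_assoc]
  · simp only [ncESeries, mul_add, mul_one, map_add, ← mul_assoc, PowerSeries.coeff_succ_mul_X,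
      PowerSeries.coeff_mul_C, PowerSeries.coeff_mk, ncEsymm_insert u h]

theorem ncHSeries_insert {a : α} {S : Finset α} (h : ∀ b ∈ S, a < b) :
    ncHSeries u (insert a S) = (1 - PowerSeries.C (u a) * PowerSeries.X) * ncHSeries u S := by
  ext d
  rcases d with _ | d
  · simp [ncHSeries, sub_mul, mul_assoc]
  · have hcomm : u a * (-1) ^ d = (-1) ^ d * u a := ((Commute.neg_one_right (u a)).pow_right d).eq
    simp only [ncHSeries, sub_mul, one_mul, map_sub, mul_assoc, PowerSeries.coeff_C_mul,
      PowerSeries.coeff_succ_X_mul, PowerSeries.coeff_mk, ncHsymm_insert u h]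
    rw [← mul_assoc (u a), hcomm, pow_succ]
    noncomm_ring

theorem IsLamFamily.ncHSeries_mul_ncESeries {u : α → A} (hu : IsLamFamily u) (S : Finset α) :
    ncHSeries u S * ncESeries u S = 1 := by
  induction S using Finset.induction_on_min with
  | empty => rw [ncESeries_empty, ncHSeries_empty, one_mul]
  | insert a S h ih =>
    have hsq : PowerSeries.C (u a) * PowerSeries.X * (PowerSeries.C (u a) * PowerSeries.X) = 0 := by
      rw [mul_assoc, ← mul_assoc PowerSeries.X, PowerSeries.X_mul, ← mul_assoc, ← mul_assoc,
        ← map_mul, hu.mul_self, map_zero, zero_mul, zero_mul]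
    rw [ncESeries_insert u h, ncHSeries_insert u h, mul_assoc, ← mul_assoc (ncHSeries u S), ih,
      one_mul, sub_mul, one_mul, mul_add, mul_one, hsq, add_zero, add_sub_cancel_right]

theorem IsLamFamily.sum_antidiagonal_ncHsymm_mul_ncEsymm {u : α → A} (hu : IsLamFamily u)
    (S : Finset α) (n : ℕ) :
    ∑ ij ∈ antidiagonal n, (-1) ^ ij.1 * ncHsymm u S ij.1 * ncEsymm u S ij.2 =
      if n = 0 then 1 else 0 := by
  simpa only [ncESeries, ncHSeries, PowerSeries.coeff_mul, PowerSeries.coeff_mk,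
    PowerSeries.coeff_one] using congrArg (PowerSeries.coeff n) (hu.ncHSeries_mul_ncESeries S)

end Ring

end NoncommutativeSymmetric

/-! ### Dual Jacobi–Trudi determinants -/

section DualJacobiTrudi

variable {R : Type*}

/-- The `T × T` dual Jacobi–Trudi matrix of a sequence `γ` of column lengths. -/
def eMatrix (E : ℤ → R) (T : ℕ) (γ : ℕ → ℕ) : Matrix (Fin T) (Fin T) R :=
  Matrix.of fun i j => E ((γ i : ℤ) + ((j : ℕ) : ℤ) - ((i : ℕ) : ℤ))

/-- The sequence `γ` with `1` added at the places in `s`. -/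
def addIndicator (γ : ℕ → ℕ) (s : Finset ℕ) (i : ℕ) : ℕ := γ i + if i ∈ s then 1 else 0

variable [CommRing R]

theorem det_eMatrix_eq_zero (E : ℤ → R) {T i : ℕ} (hi : i + 1 < T) {γ : ℕ → ℕ}
    (h : γ (i + 1) = γ i + 1) : (eMatrix E T γ).det = 0 := by
  refine Matrix.det_zero_of_row_eq (i := ⟨i, by lia⟩) (j := ⟨i + 1, hi⟩) (by simp) ?_
  ext j
  simp only [eMatrix, Matrix.of_apply, h]
  congr 1
  push_cast
  ring

theorem det_of_succ_add_mul_castSucc {T : ℕ} (M : Matrix (Fin T) (Fin (T + 1)) R) (z : R) :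
    (Matrix.of fun i j => M i j.succ + z * M i j.castSucc).det =
      ∑ j : Fin (T + 1), z ^ (j : ℕ) * (M.submatrix id j.succAbove).det := by
  let bordered : Matrix (Fin (T + 1)) (Fin (T + 1)) R :=
    Matrix.of fun i j => Fin.cases ((-z) ^ (j : ℕ)) (fun i => M i j) i
  let reduced : Matrix (Fin (T + 1)) (Fin (T + 1)) R := Matrix.of fun i j =>
    Fin.cases (bordered i 0) (fun j => bordered i j.succ + z * bordered i j.castSucc) j
  have hdet : bordered.det = reduced.det := by
    refine Matrix.det_eq_of_forall_col_eq_smul_add_pred (fun _ => -z) (fun _ => rfl) fun i j => ?_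
    change bordered i j.succ = bordered i j.succ + z * bordered i j.castSucc +
      -z * bordered i j.castSucc
    ring
  have hbordered_det : bordered.det =
      ∑ j : Fin (T + 1), z ^ (j : ℕ) * (M.submatrix id j.succAbove).det := by
    rw [Matrix.det_succ_row_zero]
    refine Finset.sum_congr rfl fun j _ => ?_
    have hminor : bordered.submatrix Fin.succ j.succAbove = M.submatrix id j.succAbove := rfl
    have hentry : bordered 0 j = (-z) ^ (j : ℕ) := rfl
    rw [hminor, hentry, ← mul_pow, neg_one_mul, neg_neg]
  have hreduced_det : reduced.det =
      (Matrix.of fun i j => M i j.succ + z * M i j.castSucc).det := by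
    rw [Matrix.det_succ_row_zero, Fin.sum_univ_succ, Finset.sum_eq_zero, add_zero]
    · have hminor : reduced.submatrix Fin.succ (Fin.succAbove 0) =
          Matrix.of fun i j => M i j.succ + z * M i j.castSucc := rfl
      have hentry : reduced 0 0 = 1 := pow_zero (-z)
      rw [hminor, hentry, Fin.val_zero, pow_zero, one_mul, one_mul]
    · intro j _
      have hentry : reduced 0 j.succ = (-z) ^ (j + 1 : ℕ) + z * (-z) ^ (j : ℕ) := rfl
      rw [hentry, pow_succ']
      ring
  rw [← hreduced_det, ← hdet, hbordered_det]

theorem sum_powersetCard_det_of_ite {T : ℕ} (M : Matrix (Fin T) (Fin (T + 1)) R)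
    (j : Fin (T + 1)) :
    ∑ s ∈ powersetCard (T - j) (Finset.univ : Finset (Fin T)),
      (Matrix.of fun i l => M i (if i ∈ s then l.succ else l.castSucc)).det =
      (M.submatrix id j.succAbove).det := by
  open Polynomial in
  have hC : ∀ {n : ℕ} (A : Matrix (Fin n) (Fin n) R), (A.map C).det = C A.det := fun A =>
    (RingHom.map_det C A).symm
  have hexpand : (Matrix.of fun i l : Fin T => C (M i l.succ) + X * C (M i l.castSucc)).det =
      ∑ s : Finset (Fin T), X ^ (T - s.card) *
        C (Matrix.of fun i l => M i (if i ∈ s then l.succ else l.castSucc)).det := by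
    refine ((Matrix.detRowAlternating (R := R[X]) (n := Fin T)).toMultilinearMap.map_add_univ
      (fun i l => C (M i l.succ)) fun i l => X * C (M i l.castSucc)).trans ?_
    refine Finset.sum_congr rfl fun s _ => ?_
    have hprod : ∏ i : Fin T, (if i ∈ s then 1 else X) = (X : R[X]) ^ (T - s.card) := by
      simp [Finset.prod_ite, Finset.filter_not, Finset.card_sdiff]
    rw [← hC, ← hprod, ← Matrix.det_mul_column]
    refine congrArg Matrix.det ?_
    ext1 i l
    by_cases hi : i ∈ s <;> simp [Finset.piecewise, hi]
  have hcoeff := congrArg (fun p => p.coeff (j : ℕ))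
    (hexpand.symm.trans (det_of_succ_add_mul_castSucc (M.map C) X))
  have hsubmatrix : ∀ l : Fin (T + 1), (M.map C).submatrix id l.succAbove =
      (M.submatrix id l.succAbove).map C := fun _ => rfl
  simp only [hsubmatrix, hC, finsetSum_coeff, X_pow_mul_C, coeff_C_mul_X_pow, Fin.val_inj,
    Finset.sum_ite_eq, Finset.mem_univ, if_true] at hcoeff
  rw [← hcoeff, ← Finset.sum_filter, Finset.powersetCard_eq_filter, Finset.powerset_univ]
  refine Finset.sum_congr (Finset.filter_congr fun s _ => ?_) fun _ _ => rfl
  have hs := card_finset_fin_le s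
  lia

/-- Sequences `E` and `H` that satisfy the relations `E(t) H(-t) = 1` between the elementary and
the complete homogeneous symmetric functions; `E` is extended by `0` to negative indices. -/
structure IsDualPair (E : ℤ → R) (H : ℕ → R) : Prop where
  of_neg : ∀ d < 0, E d = 0
  zero : E 0 = 1
  sum_antidiagonal : ∀ n, ∑ ij ∈ antidiagonal n, (-1) ^ ij.1 * H ij.1 * E (ij.2 : ℕ) =
    if n = 0 then 1 else 0

namespace IsDualPair

variable {E : ℤ → R} {H : ℕ → R}

theorem sum_range_mul (h : IsDualPair E H) {d : ℤ} {m : ℕ} (hd : d ≤ m) :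
    ∑ b ∈ Finset.range (m + 1), (-1) ^ b * H b * E (d - b) = if d = 0 then 1 else 0 := by
  rcases lt_or_ge d 0 with hneg | hpos
  · rw [if_neg hneg.ne, Finset.sum_eq_zero fun b _ => by rw [h.of_neg _ (by lia), mul_zero]]
  lift d to ℕ using hpos
  have hsub : Finset.range (d + 1) ⊆ Finset.range (m + 1) := Finset.range_mono (by lia)
  rw [← Finset.sum_subset hsub]
  · simp only [Nat.cast_eq_zero]
    rw [← h.sum_antidiagonal,
      Finset.Nat.sum_antidiagonal_eq_sum_range_succ fun b i : ℕ => (-1) ^ b * H b * E i]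
    refine Finset.sum_congr rfl fun b hb => ?_
    rw [Nat.cast_sub (Finset.mem_range_succ_iff.1 hb)]
  · intro b _ hb
    rw [Finset.mem_range] at hb
    rw [h.of_neg _ (by lia), mul_zero]

theorem det_eMatrix_succ (h : IsDualPair E H) {T : ℕ} {γ : ℕ → ℕ} (hγ : γ T = 0) :
    (eMatrix E (T + 1) γ).det = (eMatrix E T γ).det := by
  rw [Matrix.det_succ_row _ (Fin.last T), Fin.sum_univ_castSucc, Finset.sum_eq_zero, zero_add]
  · simp only [← two_mul, Fin.val_last, even_two, Even.mul_right, Even.neg_pow, one_pow, eMatrix,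
      Matrix.of_apply, hγ, Nat.cast_zero, zero_add, sub_self, h.zero, mul_one, one_mul,
      Fin.succAbove_last]
    rfl
  · intro j _
    have hzero : eMatrix E (T + 1) γ (Fin.last T) j.castSucc = 0 := by
      rw [eMatrix, Matrix.of_apply, Fin.val_last, hγ]
      exact h.of_neg _ (by simp)
    rw [hzero, mul_zero, zero_mul]

theorem det_eMatrix_of_le (h : IsDualPair E H) {t T : ℕ} (hT : t ≤ T) {γ : ℕ → ℕ}
    (hγ : ∀ i, t ≤ i → γ i = 0) : (eMatrix E T γ).det = (eMatrix E t γ).det := by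
  induction T, hT using Nat.le_induction with
  | base => rfl
  | succ T hT ih => rw [h.det_eMatrix_succ (hγ T hT), ih]

theorem sum_range_mul_eMatrix (h : IsDualPair E H) {n m j : ℕ} (hj : j ≤ n + m) {γ : ℕ → ℕ}
    (hγ : ∀ i, n ≤ i → γ i = 0) :
    ∑ i ∈ Finset.range (n + m + 1), (if n ≤ i then (-1) ^ (i - n) * H (i - n) else 0) *
      E ((γ i : ℤ) + (j : ℤ) - (i : ℤ)) = if j = n then 1 else 0 := by
  rw [add_assoc, Finset.sum_range_add, Finset.sum_eq_zero, zero_add]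
  · have hsum := h.sum_range_mul (d := (j : ℤ) - n) (m := m) (by lia)
    simp only [sub_eq_zero, Nat.cast_inj] at hsum
    rw [← hsum]
    refine Finset.sum_congr rfl fun b _ => ?_
    rw [if_pos (n.le_add_right b), Nat.add_sub_cancel_left, hγ _ (n.le_add_right b)]
    congr 2
    push_cast
    ring
  · intro i hi
    rw [if_neg (by simpa using hi), zero_mul]

theorem mul_det_eMatrix (h : IsDualPair E H) {n m : ℕ} {γ : ℕ → ℕ} (hγ : ∀ i, n ≤ i → γ i = 0) :
    H m * (eMatrix E (n + m) γ).det =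
      ((eMatrix E (n + m + 1) γ).submatrix Fin.castSucc
        (⟨n, by lia⟩ : Fin (n + m + 1)).succAbove).det := by
  set A := eMatrix E (n + m + 1) γ
  set c : Fin (n + m + 1) → R := fun i =>
    if n ≤ (i : ℕ) then (-1) ^ ((i : ℕ) - n) * H (i - n) else 0 with hc
  have hrow : ∑ i, c i • A i = Pi.single ⟨n, by lia⟩ 1 := by
    ext j
    have hj := h.sum_range_mul_eMatrix (Nat.lt_succ_iff.1 j.2) hγ
    rw [← Fin.sum_univ_eq_sum_range fun i => (if n ≤ i then (-1) ^ (i - n) * H (i - n) else 0) *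
      E ((γ i : ℤ) + ((j : ℕ) : ℤ) - (i : ℤ))] at hj
    rw [Finset.sum_apply, Pi.single_apply]
    simp only [Fin.ext_iff]
    exact hj
  have hlast : c (Fin.last (n + m)) = (-1) ^ m * H m := by simp [hc]
  have hsign : (-1 : R) ^ (n + m + n) = (-1) ^ m := by
    rw [add_right_comm, pow_add, ← two_mul, pow_mul, neg_one_sq, one_pow, one_mul]
  have hdet := Matrix.det_updateRow_sum A (Fin.last (n + m)) c
  rw [hrow, h.det_eMatrix_succ (hγ _ (n.le_add_right m)), hlast, Matrix.det_succ_row _ (Fin.last _),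
    Finset.sum_eq_single ⟨n, by lia⟩, Matrix.updateRow_self, Pi.single_eq_same,
    Matrix.submatrix_updateRow_succAbove, Fin.succAbove_last, Fin.val_last, hsign, smul_eq_mul,
    mul_one, mul_assoc] at hdet
  · exact ((isUnit_one.neg.pow m).mul_left_cancel hdet).symm
  · intro j _ hj
    rw [Matrix.updateRow_self, Pi.single_eq_of_ne hj, mul_zero, zero_mul]
  · simp

theorem mul_det_eMatrix_eq_sum (h : IsDualPair E H) {n m : ℕ} {γ : ℕ → ℕ}
    (hγ : ∀ i, n ≤ i → γ i = 0) :
    H m * (eMatrix E (n + m) γ).det =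
      ∑ s ∈ powersetCard m (Finset.range (n + m)), (eMatrix E (n + m) (addIndicator γ s)).det := by
  have hsum := sum_powersetCard_det_of_ite
    ((eMatrix E (n + m + 1) γ).submatrix Fin.castSucc id) ⟨n, by lia⟩
  rw [Matrix.submatrix_submatrix, Nat.add_sub_cancel_left] at hsum
  rw [h.mul_det_eMatrix hγ, ← Nat.Iio_eq_range, ← Fin.map_valEmbedding_univ,
    Finset.powersetCard_map, Finset.sum_map]
  refine hsum.symm.trans (Finset.sum_congr rfl fun s _ => congrArg Matrix.det ?_)
  ext i l
  have hmem : (i : ℕ) ∈ (Finset.mapEmbedding Fin.valEmbedding).toEmbedding s ↔ i ∈ s :=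
    Finset.mem_map' Fin.valEmbedding
  simp only [eMatrix, addIndicator, Matrix.of_apply, Matrix.submatrix_apply, Fin.val_castSucc, id,
    hmem]
  by_cases hi : i ∈ s
  · rw [if_pos hi, if_pos hi, Fin.val_succ]
    push_cast
    ring_nf
  · rw [if_neg hi, if_neg hi, Fin.val_castSucc, add_zero]

end IsDualPair

end DualJacobiTrudi

/-! ### Young diagrams and horizontal strips -/

section YoungDiagrams

variable {μ ν : YoungDiagram}

theorem colLen_le_card (μ : YoungDiagram) (j : ℕ) : μ.colLen j ≤ μ.card := by
  rw [YoungDiagram.colLen_eq_card]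
  exact Finset.card_le_card (Finset.filter_subset _ _)

theorem rowLen_le_card (μ : YoungDiagram) (i : ℕ) : μ.rowLen i ≤ μ.card := by
  rw [YoungDiagram.rowLen_eq_card]
  exact Finset.card_le_card (Finset.filter_subset _ _)

theorem colLen_eq_zero_iff {j : ℕ} : μ.colLen j = 0 ↔ μ.rowLen 0 ≤ j := by
  rw [← not_lt, ← mem_iff_lt_rowLen, mem_iff_lt_colLen, not_lt, Nat.le_zero]

theorem colLen_eq_zero_of_card_le {j : ℕ} (h : μ.card ≤ j) : μ.colLen j = 0 :=
  colLen_eq_zero_iff.2 ((rowLen_le_card μ 0).trans h)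

theorem colLen_injective : Function.Injective YoungDiagram.colLen := fun μ ν h =>
  SetLike.ext fun ⟨i, j⟩ => by rw [mem_iff_lt_colLen, mem_iff_lt_colLen, h]

theorem card_eq_sum_colLen {T : ℕ} (h : μ.rowLen 0 ≤ T) :
    μ.card = ∑ j ∈ Finset.range T, μ.colLen j := by
  have hcols : ∀ c ∈ μ.cells, c.2 ∈ Finset.range T := fun c hc => Finset.mem_range.2
    ((mem_iff_lt_rowLen.1 (μ.up_left_mem (Nat.zero_le c.1) le_rfl hc)).trans_le h)
  rw [YoungDiagram.card, Finset.card_eq_sum_card_fiberwise hcols]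
  refine Finset.sum_congr rfl fun j _ => ?_
  rw [YoungDiagram.colLen_eq_card]
  rfl

theorem exists_colLen_eq {δ : ℕ → ℕ} (hδ : Antitone δ) {T : ℕ} (hT : δ T = 0) :
    ∃ μ : YoungDiagram, μ.colLen = δ := by
  have hlower : IsLowerSet ((Finset.range (δ 0) ×ˢ Finset.range T).filter fun c => c.1 < δ c.2 :
      Set (ℕ × ℕ)) := by
    rintro ⟨i, j⟩ ⟨i', j'⟩ hle hc
    obtain ⟨hi, hj⟩ := Prod.mk_le_mk.1 hle
    have hδj := hδ hj
    simp only [Finset.coe_filter, Finset.mem_product, Finset.mem_range, Set.mem_ofPred_eq] at hc ⊢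
    lia
  refine ⟨⟨_, hlower⟩, funext fun j => eq_of_forall_lt_iff fun i => ?_⟩
  rw [← mem_iff_lt_colLen, ← YoungDiagram.mem_cells]
  simp only [Finset.mem_filter, Finset.mem_product, Finset.mem_range]
  refine ⟨fun h => h.2, fun h => ⟨⟨h.trans_le (hδ j.zero_le), ?_⟩, h⟩⟩
  by_contra! hj
  exact absurd (h.trans_le ((hδ hj).trans hT.le)) (Nat.not_lt_zero i)

theorem finite_setOf_card_eq (n : ℕ) : {μ : YoungDiagram | μ.card = n}.Finite := by
  refine Set.Finite.of_finite_image (f := YoungDiagram.cells)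
    ((Finset.finite_toSet (Finset.range n ×ˢ Finset.range n).powerset).subset ?_)
    fun _ _ _ _ => YoungDiagram.ext
  rintro _ ⟨μ, rfl, rfl⟩
  rw [Finset.mem_coe, Finset.mem_powerset]
  intro c hc
  exact Finset.mem_product.2
    ⟨Finset.mem_range.2 ((mem_iff_lt_colLen.1 hc).trans_le (colLen_le_card μ _)),
      Finset.mem_range.2 ((mem_iff_lt_rowLen.1 hc).trans_le (rowLen_le_card μ _))⟩

/-- The finite set of Young diagrams with `n` cells, i.e. of partitions of `n`. -/
def diagramsOfCard (n : ℕ) : Finset YoungDiagram := (finite_setOf_card_eq n).toFinset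

@[simp] theorem mem_diagramsOfCard {n : ℕ} : μ ∈ diagramsOfCard n ↔ μ.card = n := by
  simp [diagramsOfCard]

/-- The skew diagram `ν / μ` is a horizontal strip: `μ ⊆ ν`, and `ν / μ` has at most one cell in
each column. -/
def IsHorizontalStrip (μ ν : YoungDiagram) : Prop :=
  ∀ j, μ.colLen j ≤ ν.colLen j ∧ ν.colLen j ≤ μ.colLen j + 1

theorem IsHorizontalStrip.le (h : IsHorizontalStrip μ ν) : μ ≤ ν := fun c hc =>
  mem_iff_lt_colLen.2 ((mem_iff_lt_colLen.1 hc).trans_le (h c.2).1)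

/-- The columns in which `ν` has exactly one cell more than `μ`. -/
def addedColumns (μ ν : YoungDiagram) : Finset ℕ :=
  (Finset.range (ν.rowLen 0)).filter fun j => ν.colLen j = μ.colLen j + 1

theorem mem_addedColumns {j : ℕ} : j ∈ addedColumns μ ν ↔ ν.colLen j = μ.colLen j + 1 := by
  rw [addedColumns, Finset.mem_filter, Finset.mem_range, ← not_le, ← colLen_eq_zero_iff]
  lia

theorem IsHorizontalStrip.colLen_eq_addIndicator (h : IsHorizontalStrip μ ν) :
    ν.colLen = addIndicator μ.colLen (addedColumns μ ν) := by
  funext j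
  have hj := h j
  simp only [addIndicator, mem_addedColumns]
  split_ifs <;> lia

section AddIndicator

variable {s : Finset ℕ} (h : ν.colLen = addIndicator μ.colLen s)
include h

theorem isHorizontalStrip_of_colLen_eq_addIndicator : IsHorizontalStrip μ ν := fun j => by
  rw [h, addIndicator]
  split_ifs <;> lia

theorem addedColumns_eq_of_colLen_eq_addIndicator : addedColumns μ ν = s := by
  ext j
  rw [mem_addedColumns, h, addIndicator, Nat.add_left_cancel_iff]
  split_ifs with hj <;> simp [hj]

theorem card_of_colLen_eq_addIndicator : ν.card = μ.card + s.card := by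
  have hs : s ⊆ Finset.range (ν.rowLen 0) := by
    rw [← addedColumns_eq_of_colLen_eq_addIndicator h]
    exact Finset.filter_subset _ _
  have hμ : μ.rowLen 0 ≤ ν.rowLen 0 := by
    have hstrip := (isHorizontalStrip_of_colLen_eq_addIndicator h (ν.rowLen 0)).1
    rwa [colLen_eq_zero_iff.2 le_rfl, Nat.le_zero, colLen_eq_zero_iff] at hstrip
  rw [card_eq_sum_colLen le_rfl, card_eq_sum_colLen hμ, h]
  simp only [addIndicator, Finset.sum_add_distrib, Finset.sum_boole, Nat.cast_id]
  rw [Finset.filter_mem_eq_inter, Finset.inter_eq_right.2 hs]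

end AddIndicator

variable {R : Type*} [CommRing R] {E : ℤ → R} {H : ℕ → R}

/-- The dual Jacobi–Trudi determinant `det (E (μ'_i + j - i))` of the partition `μ`, which expresses
the Schur function `s_μ` through the elementary symmetric functions `E`. -/
def dualJacobiTrudi (E : ℤ → R) (μ : YoungDiagram) : R := (eMatrix E (μ.rowLen 0) μ.colLen).det

theorem IsDualPair.det_eMatrix_colLen (h : IsDualPair E H) {T : ℕ} (hT : μ.rowLen 0 ≤ T) :
    (eMatrix E T μ.colLen).det = dualJacobiTrudi E μ :=
  h.det_eMatrix_of_le hT fun _ => colLen_eq_zero_iff.2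

theorem antitone_addIndicator_of_det_ne_zero {γ : ℕ → ℕ} (hγ : Antitone γ) {s : Finset ℕ} {T : ℕ}
    (hT : ∀ i, T ≤ i → addIndicator γ s i = 0) (hdet : (eMatrix E T (addIndicator γ s)).det ≠ 0) :
    Antitone (addIndicator γ s) := by
  refine antitone_nat_of_succ_le fun i => ?_
  rcases lt_or_ge (i + 1) T with hi | hi
  · by_contra hlt
    refine hdet (det_eMatrix_eq_zero E hi ?_)
    have hanti := hγ i.le_succ
    simp only [addIndicator] at hlt ⊢
    split_ifs at hlt ⊢ <;> lia
  · rw [hT _ hi]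
    exact Nat.zero_le _

open scoped Classical in
theorem IsDualPair.mul_dualJacobiTrudi (h : IsDualPair E H) (μ : YoungDiagram) (k : ℕ) :
    H k * dualJacobiTrudi E μ =
      ∑ ν ∈ (diagramsOfCard (μ.card + k)).filter (IsHorizontalStrip μ), dualJacobiTrudi E ν := by
  have hμ : ∀ {i}, μ.card ≤ i → μ.colLen i = 0 := colLen_eq_zero_of_card_le
  rw [← h.det_eMatrix_colLen ((rowLen_le_card μ 0).trans (Nat.le_add_right _ k)),
    h.mul_det_eMatrix_eq_sum fun _ => hμ]
  refine (Finset.sum_of_injOn (addedColumns μ) ?_ ?_ ?_ ?_).symm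
  · intro ν hν ν' hν' heq
    refine colLen_injective ?_
    rw [(Finset.mem_filter.1 hν).2.colLen_eq_addIndicator,
      (Finset.mem_filter.1 hν').2.colLen_eq_addIndicator, heq]
  · intro ν hν
    obtain ⟨hcard, hstrip⟩ := Finset.mem_filter.1 hν
    rw [mem_diagramsOfCard] at hcard
    have hsum := card_of_colLen_eq_addIndicator hstrip.colLen_eq_addIndicator
    refine Finset.mem_powersetCard.2 ⟨(Finset.filter_subset _ _).trans ?_, by lia⟩
    exact Finset.range_mono ((rowLen_le_card ν 0).trans_eq hcard)
  · intro s hs hnotMem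
    obtain ⟨hsub, hcard⟩ := Finset.mem_powersetCard.1 hs
    by_contra hdet
    have hzero : ∀ i, μ.card + k ≤ i → addIndicator μ.colLen s i = 0 := fun i hi => by
      rw [addIndicator, hμ (by lia), if_neg fun his => (Finset.mem_range.1 (hsub his)).not_ge hi]
    obtain ⟨ν, hν⟩ := exists_colLen_eq
      (antitone_addIndicator_of_det_ne_zero (fun _ _ => μ.colLen_anti _ _) hzero hdet)
      (hzero _ le_rfl)
    refine hnotMem ⟨ν, Finset.mem_filter.2 ⟨?_, isHorizontalStrip_of_colLen_eq_addIndicator hν⟩,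
      addedColumns_eq_of_colLen_eq_addIndicator hν⟩
    rw [mem_diagramsOfCard, card_of_colLen_eq_addIndicator hν, hcard]
  · intro ν hν
    obtain ⟨hcard, hstrip⟩ := Finset.mem_filter.1 hν
    rw [mem_diagramsOfCard] at hcard
    rw [← hstrip.colLen_eq_addIndicator, h.det_eMatrix_colLen (hcard ▸ rowLen_le_card ν 0)]

end YoungDiagrams

/-! ### Semistandard tableaux and Kostka numbers -/

section Kostka

variable {μ ν : YoungDiagram} {m : ℕ →₀ ℕ} {p : ℕ}

/-- The content of a semistandard Young tableau: the multiplicities of its entries. -/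
def tableauContent (T : SemistandardYoungTableau μ) : ℕ →₀ ℕ :=
  ∑ c ∈ μ.cells, Finsupp.single (T c.1 c.2) 1

/-- The Kostka number: the number of semistandard Young tableaux of shape `μ` and content `m`. -/
def kostka (μ : YoungDiagram) (m : ℕ →₀ ℕ) : ℕ :=
  Set.ncard {T : SemistandardYoungTableau μ | tableauContent T = m}

theorem degree_tableauContent (T : SemistandardYoungTableau μ) :
    (tableauContent T).degree = μ.card := by
  simp [tableauContent, map_sum, YoungDiagram.card]

theorem tableauContent_apply (T : SemistandardYoungTableau μ) (i : ℕ) :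
    tableauContent T i = (μ.cells.filter fun c => T c.1 c.2 = i).card := by
  rw [tableauContent, Finsupp.finsetSum_apply, Finset.card_filter]
  simp only [Finsupp.single_apply]

theorem entry_lt_of_tableauContent_eq_zero {T : SemistandardYoungTableau μ}
    (hT : ∀ i, p ≤ i → tableauContent T i = 0) (i j : ℕ) (hc : (i, j) ∈ μ) : T i j < p := by
  by_contra! hp
  have hzero := hT _ hp
  rw [tableauContent_apply, Finset.card_eq_zero, Finset.filter_eq_empty_iff] at hzero
  exact hzero ((YoungDiagram.mem_cells _).2 hc) rfl

theorem exists_forall_le_eq_zero (m : ℕ →₀ ℕ) : ∃ p, ∀ i, p ≤ i → m i = 0 := by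
  obtain ⟨p, hp⟩ := m.support.exists_nat_subset_range
  exact ⟨p, fun i hi => Finsupp.notMem_support_iff.1 fun him =>
    (Finset.mem_range.1 (hp him)).not_ge hi⟩

theorem tableau_ext {T T' : SemistandardYoungTableau μ} (h : ∀ i j, (i, j) ∈ μ → T i j = T' i j) :
    T = T' := by
  refine SemistandardYoungTableau.ext fun i j => ?_
  by_cases hc : (i, j) ∈ μ
  · exact h i j hc
  · rw [T.zeros hc, T'.zeros hc]

theorem finite_setOf_tableauContent_eq (μ : YoungDiagram) (m : ℕ →₀ ℕ) :
    {T : SemistandardYoungTableau μ | tableauContent T = m}.Finite := by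
  obtain ⟨p, hp⟩ := exists_forall_le_eq_zero m
  refine Set.Finite.of_finite_image (f := fun T (c : μ.cells) => T c.1.1 c.1.2)
    ((Set.Finite.pi' (t := fun _ => Set.Iio p) fun _ => Set.finite_Iio p).subset ?_) ?_
  · rintro _ ⟨T, rfl, rfl⟩ c
    exact entry_lt_of_tableauContent_eq_zero hp _ _ c.2
  · exact fun T _ T' _ h => tableau_ext fun i j hc => congrFun h ⟨(i, j), hc⟩

theorem kostka_eq_zero_of_degree_ne (h : m.degree ≠ μ.card) : kostka μ m = 0 := by
  rw [kostka, Set.ncard_eq_zero (finite_setOf_tableauContent_eq μ m),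
    Set.eq_empty_iff_forall_notMem]
  rintro T rfl
  exact h (degree_tableauContent T)

theorem kostka_bot_zero : kostka ⊥ 0 = 1 := by
  rw [kostka, Set.ncard_eq_one]
  refine ⟨default, Set.eq_singleton_iff_unique_mem.2 ⟨?_, fun T _ => ?_⟩⟩
  · simp [tableauContent]
  · exact tableau_ext fun i j hc => absurd hc (YoungDiagram.notMem_bot _)

/-- The diagram of the cells of a tableau whose entries are less than `p`. -/
def subshape (T : SemistandardYoungTableau ν) (p : ℕ) : YoungDiagram where
  cells := ν.cells.filter fun c => T c.1 c.2 < p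
  isLowerSet := by
    rintro ⟨i, j⟩ ⟨i', j'⟩ hle hc
    obtain ⟨hi, hj⟩ := Prod.mk_le_mk.1 hle
    simp only [Finset.coe_filter, Set.mem_ofPred_eq, YoungDiagram.mem_cells] at hc ⊢
    exact ⟨ν.up_left_mem hi hj hc.1, ((T.row_weak_of_le hj (ν.up_left_mem hi le_rfl hc.1)).trans
      (T.col_weak hi hc.1)).trans_lt hc.2⟩

theorem mem_subshape {T : SemistandardYoungTableau ν} {i j : ℕ} :
    (i, j) ∈ subshape T p ↔ (i, j) ∈ ν ∧ T i j < p := by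
  rw [← YoungDiagram.mem_cells, subshape, Finset.mem_filter, YoungDiagram.mem_cells]

theorem isHorizontalStrip_subshape {T : SemistandardYoungTableau ν}
    (hT : ∀ i j, (i, j) ∈ ν → T i j ≤ p) : IsHorizontalStrip (subshape T p) ν := by
  intro j
  constructor
  · by_contra! hlt
    exact lt_irrefl _ (mem_iff_lt_colLen.1 (mem_subshape.1 (mem_iff_lt_colLen.2 hlt)).1)
  · by_contra! hlt
    have hbelow : ((subshape T p).colLen j + 1, j) ∈ ν := mem_iff_lt_colLen.2 hlt
    have hmem : ((subshape T p).colLen j, j) ∈ subshape T p :=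
      mem_subshape.2 ⟨ν.up_left_mem (Nat.le_succ _) le_rfl hbelow,
        (T.col_strict (Nat.lt_succ_self _) hbelow).trans_le (hT _ _ hbelow)⟩
    exact lt_irrefl _ (mem_iff_lt_colLen.1 hmem)

/-- The restriction of a tableau to its entries less than `p`. -/
def restrictTableau (T : SemistandardYoungTableau ν) (p : ℕ) :
    SemistandardYoungTableau (subshape T p) where
  entry i j := if (i, j) ∈ subshape T p then T i j else 0
  row_weak' hj hc := by
    rw [if_pos hc, if_pos ((subshape T p).up_left_mem le_rfl hj.le hc)]
    exact T.row_weak hj (mem_subshape.1 hc).1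
  col_strict' hi hc := by
    rw [if_pos hc, if_pos ((subshape T p).up_left_mem hi.le le_rfl hc)]
    exact T.col_strict hi (mem_subshape.1 hc).1
  zeros' hc := if_neg hc

theorem restrictTableau_apply {T : SemistandardYoungTableau ν} {i j : ℕ}
    (hc : (i, j) ∈ subshape T p) : restrictTableau T p i j = T i j := if_pos hc

theorem restrictTableau_lt (T : SemistandardYoungTableau ν) (p i j : ℕ)
    (hc : (i, j) ∈ subshape T p) : restrictTableau T p i j < p :=
  (restrictTableau_apply hc).trans_lt (mem_subshape.1 hc).2

open scoped Classical in
/-- The extension of a tableau with entries less than `p` by entries `p` in a horizontal strip. -/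
def extendTableau (h : IsHorizontalStrip μ ν) (T : SemistandardYoungTableau μ)
    (hT : ∀ i j, (i, j) ∈ μ → T i j < p) : SemistandardYoungTableau ν where
  entry i j := if (i, j) ∈ μ then T i j else if (i, j) ∈ ν then p else 0
  row_weak' {i j₁ j₂} hj hc := by
    by_cases hc₂ : (i, j₂) ∈ μ
    · rw [if_pos hc₂, if_pos (μ.up_left_mem le_rfl hj.le hc₂)]
      exact T.row_weak hj hc₂
    · rw [if_neg hc₂, if_pos hc]
      split_ifs with hc₁
      · exact (hT _ _ hc₁).le
      · exact le_rfl
      · exact Nat.zero_le _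
  col_strict' {i₁ i₂ j} hi hc := by
    by_cases hc₂ : (i₂, j) ∈ μ
    · rw [if_pos hc₂, if_pos (μ.up_left_mem hi.le le_rfl hc₂)]
      exact T.col_strict hi hc₂
    · have hc₁ : (i₁, j) ∈ μ := by
        rw [mem_iff_lt_colLen] at hc ⊢
        have hj := h j
        lia
      rw [if_neg hc₂, if_pos hc, if_pos hc₁]
      exact hT _ _ hc₁
  zeros' hc := by rw [if_neg fun hcμ => hc (h.le hcμ), if_neg hc]

section ExtendTableau

variable (h : IsHorizontalStrip μ ν) {T : SemistandardYoungTableau μ}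
  (hT : ∀ i j, (i, j) ∈ μ → T i j < p)

theorem extendTableau_of_mem {i j : ℕ} (hc : (i, j) ∈ μ) : extendTableau h T hT i j = T i j :=
  if_pos hc

theorem extendTableau_of_notMem {i j : ℕ} (hc : (i, j) ∉ μ) (hcν : (i, j) ∈ ν) :
    extendTableau h T hT i j = p := (if_neg hc).trans (if_pos hcν)

theorem subshape_extendTableau : subshape (extendTableau h T hT) p = μ := by
  refine SetLike.ext fun ⟨i, j⟩ => ?_
  rw [mem_subshape]
  constructor
  · rintro ⟨hcν, hlt⟩
    by_contra hc
    exact hlt.ne (extendTableau_of_notMem h hT hc hcν)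
  · exact fun hc => ⟨h.le hc, (extendTableau_of_mem h hT hc).trans_lt (hT i j hc)⟩

theorem tableauContent_extendTableau : tableauContent (extendTableau h T hT) =
    tableauContent T + Finsupp.single p (ν.card - μ.card) := by
  have hsub : μ.cells ⊆ ν.cells := YoungDiagram.cells_subset_iff.2 h.le
  have hnew : ∑ c ∈ ν.cells \ μ.cells, Finsupp.single (extendTableau h T hT c.1 c.2) 1 =
      Finsupp.single p (ν.card - μ.card) := by
    rw [YoungDiagram.card, YoungDiagram.card, ← Finset.card_sdiff_of_subset hsub,
      ← Finsupp.smul_single_one, ← Finset.sum_const]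
    refine Finset.sum_congr rfl fun c hc => ?_
    obtain ⟨hcν, hcμ⟩ := Finset.mem_sdiff.1 hc
    rw [extendTableau_of_notMem h hT hcμ hcν]
  rw [tableauContent, ← Finset.sum_sdiff hsub, hnew, add_comm, tableauContent]
  congr 1
  exact Finset.sum_congr rfl fun c hc => by rw [extendTableau_of_mem h hT hc]

theorem eq_of_extendTableau_eq {T' : SemistandardYoungTableau μ}
    {hT' : ∀ i j, (i, j) ∈ μ → T' i j < p}
    (heq : extendTableau h T hT = extendTableau h T' hT') : T = T' :=
  tableau_ext fun i j hc => by
    rw [← extendTableau_of_mem h hT hc, heq, extendTableau_of_mem h hT' hc]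

end ExtendTableau

theorem extendTableau_restrictTableau {T : SemistandardYoungTableau ν}
    (hT : ∀ i j, (i, j) ∈ ν → T i j ≤ p) :
    extendTableau (isHorizontalStrip_subshape hT) (restrictTableau T p) (restrictTableau_lt T p) =
      T := by
  refine tableau_ext fun i j hcν => ?_
  by_cases hc : (i, j) ∈ subshape T p
  · rw [extendTableau_of_mem _ _ hc, restrictTableau_apply hc]
  · rw [extendTableau_of_notMem _ _ hc hcν]
    exact le_antisymm (not_lt.1 fun hlt => hc (mem_subshape.2 ⟨hcν, hlt⟩)) (hT i j hcν)

section AddSingle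

variable {k : ℕ} (hm : ∀ i, p ≤ i → m i = 0)
include hm

theorem entry_le_of_tableauContent_eq_add_single {T : SemistandardYoungTableau ν}
    (hT : tableauContent T = m + Finsupp.single p k) (i j : ℕ) (hc : (i, j) ∈ ν) : T i j ≤ p := by
  refine Nat.lt_succ_iff.1 (entry_lt_of_tableauContent_eq_zero (fun l hl => ?_) i j hc)
  rw [hT, Finsupp.add_apply, hm l (by lia), Finsupp.single_eq_of_ne (by lia), add_zero]

theorem tableauContent_restrictTableau {T : SemistandardYoungTableau ν}
    (hT : tableauContent T = m + Finsupp.single p k) :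
    tableauContent (restrictTableau T p) = m := by
  have hle := entry_le_of_tableauContent_eq_add_single hm hT
  have hcontent :=
    tableauContent_extendTableau (isHorizontalStrip_subshape hle) (restrictTableau_lt T p)
  rw [extendTableau_restrictTableau hle, hT] at hcontent
  have hp : tableauContent (restrictTableau T p) p = 0 := by
    rw [tableauContent_apply, Finset.card_eq_zero, Finset.filter_eq_empty_iff]
    exact fun c hc => (restrictTableau_lt T p c.1 c.2 hc).ne
  have hk := DFunLike.congr_fun hcontent p
  rw [Finsupp.add_apply, Finsupp.add_apply, hm p le_rfl, hp, Finsupp.single_eq_same,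
    Finsupp.single_eq_same, zero_add, zero_add] at hk
  rw [← hk] at hcontent
  exact (add_right_cancel hcontent).symm

theorem ncard_tableauContent_subshape_eq (h : IsHorizontalStrip μ ν) (hμ : μ.card = m.degree)
    (hν : ν.card = m.degree + k) :
    Set.ncard {T : SemistandardYoungTableau ν |
      tableauContent T = m + Finsupp.single p k ∧ subshape T p = μ} = kostka μ m := by
  have hlt : ∀ T : SemistandardYoungTableau μ, tableauContent T = m →
      ∀ i j, (i, j) ∈ μ → T i j < p := fun T hT =>
    entry_lt_of_tableauContent_eq_zero (hT ▸ hm)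
  refine (Set.ncard_congr (fun T hT => extendTableau h T (hlt T hT)) ?_ ?_ ?_).symm
  · intro T hT
    refine ⟨?_, subshape_extendTableau h (hlt T hT)⟩
    rw [tableauContent_extendTableau, hT, hμ, hν, Nat.add_sub_cancel_left]
  · exact fun T T' hT hT' => eq_of_extendTableau_eq h (hlt T hT)
  · rintro T ⟨hT, rfl⟩
    exact ⟨restrictTableau T p, tableauContent_restrictTableau hm hT,
      extendTableau_restrictTableau (entry_le_of_tableauContent_eq_add_single hm hT)⟩

open scoped Classical in
theorem kostka_add_single (hν : ν.card = m.degree + k) :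
    kostka ν (m + Finsupp.single p k) =
      ∑ μ ∈ (diagramsOfCard m.degree).filter fun μ => IsHorizontalStrip μ ν, kostka μ m := by
  have hfin := finite_setOf_tableauContent_eq ν (m + Finsupp.single p k)
  rw [kostka, Set.ncard_eq_toFinset_card _ hfin, Finset.card_eq_sum_card_fiberwise
    (f := fun T => subshape T p)
    (t := (diagramsOfCard m.degree).filter fun μ => IsHorizontalStrip μ ν)]
  · refine Finset.sum_congr rfl fun μ hμ => ?_
    rw [Finset.mem_filter, mem_diagramsOfCard] at hμ
    rw [← ncard_tableauContent_subshape_eq hm hμ.2 hμ.1 hν, ← Set.ncard_coe_finset]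
    simp only [Finset.coe_filter, Set.Finite.mem_toFinset, Set.mem_ofPred_eq]
  · intro T hT
    have hT : tableauContent T = m + Finsupp.single p k := hfin.mem_toFinset.1 hT
    refine Finset.mem_coe.2 (Finset.mem_filter.2 ⟨mem_diagramsOfCard.2 ?_,
      isHorizontalStrip_subshape (entry_le_of_tableauContent_eq_add_single hm hT)⟩)
    rw [← degree_tableauContent (restrictTableau T p), tableauContent_restrictTableau hm hT]

end AddSingle

theorem diagramsOfCard_zero : diagramsOfCard 0 = {⊥} := by
  ext μ
  rw [mem_diagramsOfCard, Finset.mem_singleton, YoungDiagram.card, Finset.card_eq_zero,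
    YoungDiagram.ext_iff, YoungDiagram.cells_bot]

theorem dualJacobiTrudi_bot {R : Type*} [CommRing R] (E : ℤ → R) : dualJacobiTrudi E ⊥ = 1 := by
  have hrow : (⊥ : YoungDiagram).rowLen 0 = 0 := Nat.le_zero.1 (rowLen_le_card ⊥ 0)
  rw [dualJacobiTrudi, hrow, Matrix.det_fin_zero]

namespace IsDualPair

variable {R : Type*} [CommRing R] {E : ℤ → R} {H : ℕ → R}

theorem sum_kostka_mul (h : IsDualPair E H) (hm : ∀ i, p ≤ i → m i = 0) (k : ℕ) :
    (∑ μ ∈ diagramsOfCard m.degree, (kostka μ m : R) * dualJacobiTrudi E μ) * H k =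
      ∑ ν ∈ diagramsOfCard (m.degree + k),
        (kostka ν (m + Finsupp.single p k) : R) * dualJacobiTrudi E ν := by
  classical
  have hpieri : ∀ μ ∈ diagramsOfCard m.degree, (kostka μ m : R) * dualJacobiTrudi E μ * H k =
      ∑ ν ∈ (diagramsOfCard (m.degree + k)).filter (IsHorizontalStrip μ),
        (kostka μ m : R) * dualJacobiTrudi E ν := fun μ hμ => by
    rw [mul_assoc, mul_comm _ (H k), h.mul_dualJacobiTrudi, mem_diagramsOfCard.1 hμ, Finset.mul_sum]
  rw [Finset.sum_mul, Finset.sum_congr rfl hpieri,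
    Finset.sum_comm' (t' := diagramsOfCard (m.degree + k))
      (s' := fun ν => (diagramsOfCard m.degree).filter fun μ => IsHorizontalStrip μ ν)]
  · refine Finset.sum_congr rfl fun ν hν => ?_
    rw [kostka_add_single hm (mem_diagramsOfCard.1 hν), Nat.cast_sum, Finset.sum_mul]
  · intro μ ν
    simp only [Finset.mem_filter]
    tauto

theorem prod_range_eq_sum_kostka (h : IsDualPair E H) (hm : ∀ i, p ≤ i → m i = 0) :
    ∏ i ∈ Finset.range p, H (m i) =
      ∑ μ ∈ diagramsOfCard m.degree, (kostka μ m : R) * dualJacobiTrudi E μ := by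
  induction p generalizing m with
  | zero =>
    obtain rfl : m = 0 := Finsupp.ext fun i => hm i i.zero_le
    rw [map_zero, diagramsOfCard_zero, Finset.sum_singleton, kostka_bot_zero, dualJacobiTrudi_bot,
      Finset.prod_range_zero, Nat.cast_one, one_mul]
  | succ p ih =>
    have herase : ∀ i, p ≤ i → m.erase p i = 0 := fun i hi => by
      rcases eq_or_ne i p with rfl | hne
      · exact Finsupp.erase_same
      · rw [Finsupp.erase_ne hne, hm i (by lia)]
    have hprod : ∏ i ∈ Finset.range p, H (m i) = ∏ i ∈ Finset.range p, H (m.erase p i) :=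
      Finset.prod_congr rfl fun i hi => by rw [Finsupp.erase_ne (Finset.mem_range.1 hi).ne]
    have hdegree : m.degree = (m.erase p).degree + m p := by
      conv_lhs => rw [← Finsupp.erase_add_single p m, map_add, Finsupp.degree_single]
    rw [Finset.prod_range_succ, hprod, ih herase, h.sum_kostka_mul herase,
      Finsupp.erase_add_single, hdegree]

end IsDualPair

end Kostka

/-! ### Schur functions and monomials -/

section SchurIndependence

open SemistandardYoungTableau (highestWeight)

variable {μ ν : YoungDiagram}

/-- The sum of the row indices of the cells of a Young diagram, the statistic usually denoted by
`n(μ)`. -/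
def rowIndexSum (μ : YoungDiagram) : ℕ := ∑ c ∈ μ.cells, c.1

theorem le_entry (T : SemistandardYoungTableau μ) {i j : ℕ} (hc : (i, j) ∈ μ) : i ≤ T i j := by
  induction i with
  | zero => exact Nat.zero_le _
  | succ i ih =>
    exact (ih (μ.up_left_mem i.le_succ le_rfl hc)).trans_lt (T.col_strict i.lt_succ_self hc)

theorem highestWeight_of_mem {i j : ℕ} (hc : (i, j) ∈ μ) : highestWeight μ i j = i := by
  rw [SemistandardYoungTableau.highestWeight_apply, if_pos hc]

theorem weight_tableauContent (T : SemistandardYoungTableau μ) :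
    Finsupp.weight (fun i : ℕ => i) (tableauContent T) = ∑ c ∈ μ.cells, T c.1 c.2 := by
  simp [tableauContent, map_sum, Finsupp.weight_single]

theorem tableauContent_highestWeight (μ : YoungDiagram) (i : ℕ) :
    tableauContent (highestWeight μ) i = μ.rowLen i := by
  rw [tableauContent_apply, YoungDiagram.rowLen_eq_card, YoungDiagram.row]
  congr 1
  exact Finset.filter_congr fun c hc => by rw [highestWeight_of_mem hc]

theorem tableauContent_highestWeight_injective :
    Function.Injective fun μ : YoungDiagram => tableauContent (highestWeight μ) := fun μ ν h =>
  SetLike.ext fun ⟨i, j⟩ => by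
    rw [YoungDiagram.mem_iff_lt_rowLen, YoungDiagram.mem_iff_lt_rowLen,
      ← tableauContent_highestWeight, ← tableauContent_highestWeight]
    exact iff_of_eq (congrArg (fun m : ℕ →₀ ℕ => j < m i) h)

theorem eq_highestWeight_of_rowIndexSum_le {T : SemistandardYoungTableau μ}
    (hT : tableauContent T = tableauContent (highestWeight ν))
    (hle : rowIndexSum ν ≤ rowIndexSum μ) : T = highestWeight μ := by
  have hrow : ∀ c ∈ μ.cells, c.1 ≤ T c.1 c.2 := fun c hc => le_entry T hc
  have hsum : ∑ c ∈ μ.cells, T c.1 c.2 = rowIndexSum ν := by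
    rw [← weight_tableauContent, hT, weight_tableauContent]
    exact Finset.sum_congr rfl fun c hc => highestWeight_of_mem hc
  have heq := (Finset.sum_eq_sum_iff_of_le hrow).1
    (le_antisymm (Finset.sum_le_sum hrow) (hsum.trans_le hle))
  exact tableau_ext fun i j hc => by rw [highestWeight_of_mem hc, ← heq (i, j) hc]

theorem kostka_highestWeight_self (μ : YoungDiagram) :
    kostka μ (tableauContent (highestWeight μ)) = 1 :=
  Set.ncard_eq_one.2 ⟨highestWeight μ, Set.eq_singleton_iff_unique_mem.2
    ⟨rfl, fun _ hT => eq_highestWeight_of_rowIndexSum_le hT le_rfl⟩⟩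

theorem kostka_highestWeight_of_ne (hle : rowIndexSum ν ≤ rowIndexSum μ) (hne : μ ≠ ν) :
    kostka μ (tableauContent (highestWeight ν)) = 0 := by
  rw [kostka, Set.ncard_eq_zero (finite_setOf_tableauContent_eq _ _),
    Set.eq_empty_iff_forall_notMem]
  intro T hT
  obtain rfl := eq_highestWeight_of_rowIndexSum_le hT hle
  exact hne (tableauContent_highestWeight_injective hT)

variable (R : Type) [CommRing R]

theorem coeff_schurFun (μ : YoungDiagram) (m : ℕ →₀ ℕ) :
    MvPowerSeries.coeff m (schurFun R μ) = (kostka μ m : R) := rfl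

theorem linearIndependent_schurFun : LinearIndependent R (schurFun R) := by
  rw [linearIndependent_iff]
  intro c hc
  by_contra hne
  obtain ⟨ν, hν, hmin⟩ := c.support.exists_min_image rowIndexSum
    (Finsupp.support_nonempty_iff.2 hne)
  have hcoeff := congrArg (MvPowerSeries.coeff (tableauContent (highestWeight ν))) hc
  rw [Finsupp.linearCombination_apply, Finsupp.sum, map_sum, Finset.sum_eq_single_of_mem ν hν,
    map_smul, coeff_schurFun, kostka_highestWeight_self, Nat.cast_one, smul_eq_mul, mul_one,
    map_zero] at hcoeff
  · exact Finsupp.mem_support_iff.1 hν hcoeff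
  · intro μ hμ hne
    rw [map_smul, coeff_schurFun, kostka_highestWeight_of_ne (hmin μ hμ) hne, Nat.cast_zero,
      smul_zero]

end SchurIndependence

section Monomials

variable (R : Type) [CommRing R] {N : ℕ}

/-- The variable `u_a` of the free associative algebra over `R`. -/
def ncVar (a : Fin N) : NCPoly R N := monom R (FreeMonoid.of a)

theorem monom_mul (v w : Word N) : monom R (v * w) = monom R v * monom R w :=
  map_mul (MonoidAlgebra.of R (Word N)) v w

theorem coeff_monom (v w : Word N) [Decidable (v = w)] :
    (monom R v).coeff w = if v = w then 1 else 0 := by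
  rw [monom, MonoidAlgebra.of_apply, MonoidAlgebra.coeff_single, Finsupp.single_apply]

theorem monom_ofList (l : List (Fin N)) :
    monom R (FreeMonoid.ofList l) = (l.map (ncVar R)).prod := by
  induction l with
  | nil => rfl
  | cons a l ih =>
    rw [List.map_cons, List.prod_cons, ← ih, FreeMonoid.ofList_cons, monom_mul, ncVar]

theorem coeff_mul_monom_mul (g : NCPoly R N) (x w : Word N) :
    (g * monom R w).coeff (x * w) = g.coeff x := by
  rw [monom, MonoidAlgebra.of_apply,
    MonoidAlgebra.coeff_mul_single_eq_coeff_mul x fun _ _ => mul_left_inj w, mul_one]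

theorem coeff_mul_monom_of_forall_ne (g : NCPoly R N) {v w : Word N} (h : ∀ x, x * w ≠ v) :
    (g * monom R w).coeff v = 0 :=
  MonoidAlgebra.coeff_mul_single_of_forall_mul_ne _ _ h

theorem ncElem_natCast (d : ℕ) : ncElem R N d = ncEsymm (ncVar R) Finset.univ d := by
  rw [ncElem, if_neg (by lia), ncEsymm, Int.toNat_natCast]
  exact Finset.sum_congr rfl fun _ _ => monom_ofList R _

theorem ncHsymm_ncVar (d : ℕ) : ncHsymm (ncVar R) (Finset.univ : Finset (Fin N)) d =
    ∑ S ∈ Finset.powersetCard d Finset.univ, monom R (FreeMonoid.ofList (S.sort (· ≤ ·))) :=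
  Finset.sum_congr rfl fun _ _ => (monom_ofList R _).symm

end Monomials

/-! ### Coefficients of quasisymmetric functions -/

section QuasiSymmetric

variable {N : ℕ}

/-- The weakly increasing list with `m i` entries `i`, for `i < p`. -/
def blockList (m : ℕ →₀ ℕ) (p : ℕ) : List ℕ :=
  (List.range p).flatMap fun i => List.replicate (m i) i

theorem blockList_succ (m : ℕ →₀ ℕ) (p : ℕ) :
    blockList m (p + 1) = blockList m p ++ List.replicate (m p) p := by
  simp [blockList, List.range_succ]

theorem lt_of_mem_blockList {m : ℕ →₀ ℕ} {p i : ℕ} (h : i ∈ blockList m p) : i < p := by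
  simp only [blockList, List.mem_flatMap, List.mem_range, List.mem_replicate] at h
  obtain ⟨j, hj, -, rfl⟩ := h
  exact hj

theorem pairwise_blockList (m : ℕ →₀ ℕ) (p : ℕ) : (blockList m p).Pairwise (· ≤ ·) := by
  induction p with
  | zero => exact List.Pairwise.nil
  | succ p ih =>
    rw [blockList_succ, List.pairwise_append]
    refine ⟨ih, List.pairwise_replicate_of_refl, fun a ha b hb => ?_⟩
    rw [List.eq_of_mem_replicate hb]
    exact (lt_of_mem_blockList ha).le

theorem count_blockList {m : ℕ →₀ ℕ} {p : ℕ} (hm : ∀ j, p ≤ j → m j = 0) (j : ℕ) :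
    (blockList m p).count j = m j := by
  have count_eq : (blockList m p).count j = if j < p then m j else 0 := by
    clear hm
    induction p with
    | zero => rfl
    | succ p ih =>
      rw [blockList_succ, List.count_append, ih, List.count_replicate]
      grind
  rw [count_eq]
  split_ifs with hj
  · rfl
  · exact (hm j (not_lt.1 hj)).symm

/-- The list `l` is a concatenation of strictly increasing lists of lengths `m 0, …, m (p - 1)`;
equivalently, when each letter is paired with the index of its block, the pairs increase
lexicographically. -/
def IncreasingBlocks (m : ℕ →₀ ℕ) (p : ℕ) (l : List (Fin N)) : Prop :=
  l.length = (blockList m p).length ∧ ((blockList m p).zip l).Pairwise (Prod.Lex (· < ·) (· < ·))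

theorem increasingBlocks_zero (m : ℕ →₀ ℕ) (l : List (Fin N)) :
    IncreasingBlocks m 0 l ↔ l = [] := by
  simp [IncreasingBlocks, blockList]

theorem increasingBlocks_append {m : ℕ →₀ ℕ} {p : ℕ} (x : List (Fin N)) {y : List (Fin N)}
    (hy : y.length = m p) :
    IncreasingBlocks m (p + 1) (x ++ y) ↔ IncreasingBlocks m p x ∧ y.Pairwise (· < ·) := by
  rw [IncreasingBlocks, IncreasingBlocks, blockList_succ, List.length_append, List.length_append,
    List.length_replicate, hy, Nat.add_right_cancel_iff, and_assoc]
  refine and_congr_right fun hx => ?_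
  have last_block : (List.replicate (m p) p).zip y = y.map (Prod.mk p) :=
    List.ext_getElem (by simp [hy]) fun _ _ _ => by simp
  rw [List.zip_append hx.symm, List.pairwise_append, last_block, List.pairwise_map]
  simp only [Prod.lex_def, lt_self_iff_false, true_and, false_or]
  refine and_congr_right fun _ => and_iff_left fun a ha b hb => Or.inl ?_
  obtain ⟨c, -, rfl⟩ := List.mem_map.1 hb
  exact lt_of_mem_blockList (List.of_mem_zip ha).1

theorem IncreasingBlocks.le_length {m : ℕ →₀ ℕ} {p : ℕ} {l : List (Fin N)}
    (h : IncreasingBlocks m (p + 1) l) : m p ≤ l.length := by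
  rw [h.1, blockList_succ, List.length_append, List.length_replicate]
  exact Nat.le_add_left _ _

section Coefficients

variable (R : Type) [CommRing R]

theorem coeff_mul_ncHsymm (g : NCPoly R N) (d : ℕ) (v : Word N) :
    (g * ncHsymm (ncVar R) Finset.univ d).coeff v =
      ∑ S ∈ Finset.powersetCard d Finset.univ,
        (g * monom R (FreeMonoid.ofList (S.sort (· ≤ ·)))).coeff v := by
  rw [ncHsymm_ncVar, Finset.mul_sum, MonoidAlgebra.coeff_sum, Finsupp.finsetSum_apply]

theorem coeff_mul_ncHsymm_of_length_lt (g : NCPoly R N) {d : ℕ} {l : List (Fin N)}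
    (hl : l.length < d) :
    (g * ncHsymm (ncVar R) Finset.univ d).coeff (FreeMonoid.ofList l) = 0 := by
  rw [coeff_mul_ncHsymm]
  refine Finset.sum_eq_zero fun S hS => coeff_mul_monom_of_forall_ne R g fun x hx => ?_
  have hlen := congrArg List.length (show x.toList ++ S.sort (· ≤ ·) = l from hx)
  rw [List.length_append, Finset.length_sort, (Finset.mem_powersetCard.1 hS).2] at hlen
  lia

open scoped Classical in
theorem coeff_mul_ncHsymm_append (g : NCPoly R N) (x y : List (Fin N)) :
    (g * ncHsymm (ncVar R) Finset.univ y.length).coeff (FreeMonoid.ofList (x ++ y)) =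
      if y.Pairwise (· < ·) then g.coeff (FreeMonoid.ofList x) else 0 := by
  rw [coeff_mul_ncHsymm]
  have eq_zero : ∀ S ∈ Finset.powersetCard y.length Finset.univ, S.sort (· ≤ ·) ≠ y →
      (g * monom R (FreeMonoid.ofList (S.sort (· ≤ ·)))).coeff (FreeMonoid.ofList (x ++ y)) = 0 :=
    fun S hS hne => coeff_mul_monom_of_forall_ne R g fun z hz => hne
      (List.append_inj' (show z.toList ++ S.sort (· ≤ ·) = x ++ y from hz)
        (by rw [Finset.length_sort, (Finset.mem_powersetCard.1 hS).2])).2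
  split_ifs with hy
  · have hsort : y.toFinset.sort (· ≤ ·) = y :=
      (List.toFinset_sort _ (hy.imp ne_of_lt)).2 (hy.imp le_of_lt)
    have hmem : y.toFinset ∈ Finset.powersetCard y.length Finset.univ :=
      Finset.mem_powersetCard.2
        ⟨Finset.subset_univ _, List.toFinset_card_of_nodup (hy.imp ne_of_lt)⟩
    rw [Finset.sum_eq_single_of_mem _ hmem, hsort, FreeMonoid.ofList_append, coeff_mul_monom_mul]
    exact fun S hS hne => eq_zero S hS fun h => hne (by rw [← h, Finset.sort_toFinset])
  · exact Finset.sum_eq_zero fun S hS => eq_zero S hS fun h =>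
      hy (h ▸ (Finset.sortedLT_sort S).pairwise)

open scoped Classical in
theorem coeff_prod_ncHsymm (m : ℕ →₀ ℕ) (p : ℕ) (l : List (Fin N)) :
    (((List.range p).map fun i => ncHsymm (ncVar R) Finset.univ (m i)).prod).coeff
      (FreeMonoid.ofList l) = if IncreasingBlocks m p l then 1 else 0 := by
  induction p generalizing l with
  | zero =>
    rw [increasingBlocks_zero, List.range_zero, List.map_nil, List.prod_nil,
      show (1 : NCPoly R N) = monom R 1 from rfl, coeff_monom]
    congr 1
    exact propext eq_comm
  | succ p ih =>
    rw [List.range_succ, List.map_append, List.prod_append, List.map_singleton,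
      List.prod_singleton]
    rcases lt_or_ge l.length (m p) with hlt | hge
    · rw [coeff_mul_ncHsymm_of_length_lt R _ hlt, if_neg fun h => hlt.not_ge h.le_length]
    · obtain ⟨x, y, rfl, hy⟩ : ∃ x y, l = x ++ y ∧ y.length = m p :=
        ⟨_, _, (List.take_append_drop (l.length - m p) l).symm, by rw [List.length_drop]; lia⟩
      rw [increasingBlocks_append x hy, ← hy, coeff_mul_ncHsymm_append, ih]
      grind

end Coefficients

theorem sum_single_apply {n : ℕ} (i : Fin n → ℕ) (t : ℕ) :
    (∑ j, Finsupp.single (i j) 1 : ℕ →₀ ℕ) t = (List.ofFn i).count t := by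
  induction n with
  | zero => simp
  | succ n ih =>
    rw [Fin.sum_univ_succ, Finsupp.add_apply, ih, List.ofFn_succ, List.count_cons,
      Finsupp.single_apply, add_comm]
    simp only [beq_iff_eq]

theorem ofFn_eq_blockList_iff {n : ℕ} (i : Fin n → ℕ) {m : ℕ →₀ ℕ} {p : ℕ}
    (hm : ∀ j, p ≤ j → m j = 0) :
    List.ofFn i = blockList m p ↔ Monotone i ∧ ∑ j, Finsupp.single (i j) 1 = m := by
  have content_iff : ∑ j, Finsupp.single (i j) 1 = m ↔ (List.ofFn i).Perm (blockList m p) := by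
    simp only [DFunLike.ext_iff, List.perm_iff_count, sum_single_apply, count_blockList hm]
  rw [content_iff, ← List.sortedLE_ofFn_iff]
  constructor
  · intro h
    rw [h]
    exact ⟨(pairwise_blockList m p).sortedLE, List.Perm.refl _⟩
  · rintro ⟨hsorted, hperm⟩
    exact hperm.eq_of_pairwise' hsorted.pairwise (pairwise_blockList m p)

/-- The sequence `i` is weakly increasing, and strictly increasing at the descents of `v`: the
index set of the sum that defines `Q_{Des(v)}`. -/
def IsDescentCompatible (v : Word N) (i : Fin v.toList.length → ℕ) : Prop :=
  Monotone i ∧ ∀ j j' : Fin v.toList.length, (j' : ℕ) = (j : ℕ) + 1 → (j : ℕ) ∈ descents v →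
    i j < i j'

theorem coeff_wordQSym (R : Type) [CommRing R] (v : Word N) (m : ℕ →₀ ℕ) :
    MvPowerSeries.coeff m (wordQSym R v) =
      ({i | IsDescentCompatible v i ∧ ∑ j, Finsupp.single (i j) 1 = m}.ncard : R) := by
  simp only [IsDescentCompatible, and_assoc]
  rfl

theorem pairwise_lex_ofFn_iff {v : Word N} (hv : v.toList.Nodup) (i : Fin v.toList.length → ℕ) :
    (List.ofFn fun j => (i j, v.toList.get j)).Pairwise (Prod.Lex (· < ·) (· < ·)) ↔
      IsDescentCompatible v i := by
  have consecutive : ∀ j (hj : j + 1 < v.toList.length),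
      v.toList[j] < v.toList[j + 1] ↔ j ∉ descents v := fun j hj => by
    have hne : v.toList[j] ≠ v.toList[j + 1] := fun h =>
      absurd (hv.getElem_inj_iff.1 h) (Nat.succ_ne_self j).symm
    rw [← not_le, hne.symm.le_iff_lt, descents, Set.mem_ofPred_eq, exists_prop_of_true hj]
  rw [IsDescentCompatible, ← List.isChain_iff_pairwise, ← List.sortedLE_ofFn_iff,
    List.sortedLE_iff_isChain, List.isChain_ofFn, List.isChain_ofFn]
  simp only [Prod.lex_def, List.get_eq_getElem, consecutive]
  constructor
  · refine fun h => ⟨fun j hj => (h j hj).elim le_of_lt fun h' => h'.1.le, ?_⟩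
    rintro j ⟨_, hj'⟩ rfl hdes
    exact (h j hj').resolve_right fun h' => h'.2 hdes
  · rintro ⟨hmono, hdes⟩ j hj
    by_cases hj_des : j ∈ descents v
    · exact Or.inl (hdes _ _ rfl hj_des)
    · exact (hmono j hj).lt_or_eq.imp id fun h => ⟨h, hj_des⟩

theorem increasingBlocks_iff {v : Word N} (hv : v.toList.Nodup) {m : ℕ →₀ ℕ} {p : ℕ}
    {i : Fin v.toList.length → ℕ} (hi : List.ofFn i = blockList m p) :
    IncreasingBlocks m p v.toList ↔ IsDescentCompatible v i := by
  have hzip : (List.ofFn i).zip v.toList = List.ofFn fun j => (i j, v.toList.get j) :=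
    List.ext_getElem (by simp) fun _ _ _ => by simp
  rw [IncreasingBlocks, ← hi, hzip, pairwise_lex_ofFn_iff hv]
  exact and_iff_right (List.length_ofFn).symm

open scoped Classical in
theorem coeff_wordQSym_of_nodup (R : Type) [CommRing R] {v : Word N} (hv : v.toList.Nodup)
    {m : ℕ →₀ ℕ} {p : ℕ} (hm : ∀ j, p ≤ j → m j = 0) :
    MvPowerSeries.coeff m (wordQSym R v) = if IncreasingBlocks m p v.toList then 1 else 0 := by
  have hset : {i | IsDescentCompatible v i ∧ ∑ j, Finsupp.single (i j) 1 = m} =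
      {i | List.ofFn i = blockList m p ∧ IncreasingBlocks m p v.toList} := by
    ext i
    constructor
    · rintro ⟨hcomp, hcontent⟩
      have hi := (ofFn_eq_blockList_iff i hm).2 ⟨hcomp.1, hcontent⟩
      exact ⟨hi, (increasingBlocks_iff hv hi).2 hcomp⟩
    · rintro ⟨hi, hblocks⟩
      exact ⟨(increasingBlocks_iff hv hi).1 hblocks, ((ofFn_eq_blockList_iff i hm).1 hi).2⟩
  rw [coeff_wordQSym, hset]
  split_ifs with hblocks
  · obtain ⟨i, hi⟩ : ∃ i : Fin v.toList.length → ℕ, List.ofFn i = blockList m p :=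
      ⟨fun j => (blockList m p).get (Fin.cast hblocks.1 j),
        List.ext_getElem (by simp [hblocks.1]) fun _ _ _ => by simp⟩
    have hsing : {i | List.ofFn i = blockList m p ∧ IncreasingBlocks m p v.toList} = {i} :=
      Set.eq_singleton_iff_unique_mem.2
        ⟨⟨hi, hblocks⟩, fun i' hi' => List.ofFn_injective (hi'.1.trans hi.symm)⟩
    rw [hsing, Set.ncard_singleton, Nat.cast_one]
  · simp only [hblocks, and_false, Set.ofPred_false, Set.ncard_empty, Nat.cast_zero]

end QuasiSymmetric

/-! ### The word pairing -/

section Pairing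

variable {R : Type} [CommRing R] {N : ℕ}

theorem wordPairing_monom (v : Word N) (g : NCPoly R N) :
    wordPairing R N (monom R v) g = g.coeff v := by
  rw [wordPairing, LinearMap.mk₂_apply, monom, MonoidAlgebra.of_apply, MonoidAlgebra.coeff_single,
    Finsupp.sum_single_index (zero_mul _), one_mul]

theorem wordPairing_comm (f g : NCPoly R N) : wordPairing R N f g = wordPairing R N g f := by
  classical
  rw [wordPairing, LinearMap.mk₂_apply, LinearMap.mk₂_apply,
    Finsupp.sum_of_support_subset _ Finset.subset_union_left _ fun _ _ => zero_mul _,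
    Finsupp.sum_of_support_subset _ Finset.subset_union_right _ fun _ _ => zero_mul _]
  exact Finset.sum_congr rfl fun _ _ => mul_comm _ _

theorem wordPairing_eq_of_mk'_eq {I : TwoSidedIdeal (NCPoly R N)} {f : NCPoly R N}
    (hf : f ∈ orthogonalComplement I) {x y : NCPoly R N}
    (hxy : I.ringCon.mk' x = I.ringCon.mk' y) :
    wordPairing R N x f = wordPairing R N y f := by
  have hsub := hf (x - y) (I.rel_iff x y |>.1 ((RingCon.eq _).1 hxy))
  rwa [map_sub, LinearMap.sub_apply, sub_eq_zero] at hsub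

theorem mem_orthogonalComplement_span {S : Set (NCPoly R N)} {f : NCPoly R N}
    (h : ∀ z ∈ S, ∀ v w, wordPairing R N (monom R v * z * monom R w) f = 0) :
    f ∈ orthogonalComplement (TwoSidedIdeal.span S) := by
  have hmul : ∀ z ∈ S, ∀ x y, wordPairing R N (x * z * y) f = 0 := by
    intro z hz x y
    induction x using MonoidAlgebra.induction_on with
    | of v =>
      induction y using MonoidAlgebra.induction_on with
      | of w => exact h z hz v w
      | add y y' hy hy' => rw [mul_add, map_add, LinearMap.add_apply, hy, hy', add_zero]
      | smul r y hy => rw [mul_smul_comm, map_smul, LinearMap.smul_apply, hy, smul_zero]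
    | add x x' hx hx' =>
      rw [add_mul, add_mul, map_add, LinearMap.add_apply, hx, hx', add_zero]
    | smul r x hx =>
      rw [smul_mul_assoc, smul_mul_assoc, map_smul, LinearMap.smul_apply, hx, smul_zero]
  intro z hz
  rw [TwoSidedIdeal.mem_span_iff_mem_addSubgroup_closure] at hz
  induction hz using AddSubgroup.closure_induction with
  | mem _ hz =>
    obtain ⟨_, ⟨x, -, z, hz, rfl⟩, y, -, rfl⟩ := hz
    exact hmul z hz x y
  | zero => rw [map_zero, LinearMap.zero_apply]
  | add z z' _ _ hz hz' => rw [map_add, LinearMap.add_apply, hz, hz', add_zero]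
  | neg z _ hz => rw [map_neg, LinearMap.neg_apply, hz, neg_zero]

end Pairing

section Homogeneity

variable (R : Type) [CommRing R] (N : ℕ)

/-- The noncommutative polynomials all of whose words have length `d`. The degree is an integer
because `ncElem` is indexed by integers. -/
def homogeneousPart (d : ℤ) : Submodule R (NCPoly R N) where
  carrier := {g | ∀ w : Word N, (w.toList.length : ℤ) ≠ d → g.coeff w = 0}
  add_mem' hf hg w hw := by
    rw [MonoidAlgebra.coeff_add, Finsupp.add_apply, hf w hw, hg w hw, add_zero]
  zero_mem' _ _ := rfl
  smul_mem' r g hg w hw := by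
    rw [MonoidAlgebra.coeff_smul, Finsupp.smul_apply, hg w hw, smul_zero]

variable {N}

theorem monom_mem_homogeneousPart (w : Word N) :
    monom R w ∈ homogeneousPart R N w.toList.length := by
  classical
  intro v hv
  rw [coeff_monom, if_neg]
  rintro rfl
  exact hv rfl

instance : SetLike.GradedMonoid (homogeneousPart R N) where
  one_mem := monom_mem_homogeneousPart R 1
  mul_mem d d' g g' hg hg' w hw := by
    classical
    by_contra hne
    obtain ⟨x, hx, y, hy, rfl⟩ := Finset.mem_mul.1
      (MonoidAlgebra.support_coeff_mul_subset g g' (Finsupp.mem_support_iff.2 hne))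
    have hxd := not_imp_comm.1 (hg x) (Finsupp.mem_support_iff.1 hx)
    have hyd := not_imp_comm.1 (hg' y) (Finsupp.mem_support_iff.1 hy)
    exact hw (by rw [FreeMonoid.toList_mul, List.length_append, Nat.cast_add, hxd, hyd])

theorem ncElem_mem_homogeneousPart (d : ℤ) : ncElem R N d ∈ homogeneousPart R N d := by
  rw [ncElem]
  split_ifs with hd
  · exact zero_mem _
  · refine sum_mem fun S hS => ?_
    have hlen : ((S.sort (· ≥ ·)).length : ℤ) = d := by
      rw [Finset.length_sort, (Finset.mem_powersetCard.1 hS).2, Int.toNat_of_nonneg (not_lt.1 hd)]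
    simpa only [FreeMonoid.toList_ofList, hlen] using
      monom_mem_homogeneousPart R (FreeMonoid.ofList (S.sort (· ≥ ·)))

theorem ncSchur_mem_homogeneousPart (μ : YoungDiagram) :
    ncSchur R N μ ∈ homogeneousPart R N μ.card := by
  refine sum_mem fun π _ => zsmul_mem ?_ _
  have hdeg : (List.ofFn fun i : Fin (μ.rowLen 0) =>
      (μ.colLen (i : ℕ) : ℤ) + ((π i : ℕ) : ℤ) - ((i : ℕ) : ℤ)).sum = μ.card := by
    rw [List.sum_ofFn, Finset.sum_sub_distrib, Finset.sum_add_distrib,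
      Equiv.sum_comp π fun i : Fin (μ.rowLen 0) => ((i : ℕ) : ℤ), add_sub_cancel_right,
      card_eq_sum_colLen le_rfl, ← Fin.sum_univ_eq_sum_range, Nat.cast_sum]
  rw [← hdeg]
  exact SetLike.list_prod_ofFn_mem_graded _ _ fun _ => ncElem_mem_homogeneousPart R _

end Homogeneity

/-! ### Schur expansion of `Δ(f)` for `f` orthogonal to a Lam ideal -/

namespace IsLamFamily

section CommutativeSubring

universe w

variable {α : Type*} [LinearOrder α] {A : Type w} [Ring A] {u : α → A}

theorem prod_map_eq_zero (hu : IsLamFamily u) {l : List α} (hl : ¬ l.Nodup) :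
    (l.map u).prod = 0 := by
  induction l with
  | nil => exact absurd List.nodup_nil hl
  | cons a l ih =>
    rw [List.map_cons, List.prod_cons]
    by_cases ha : a ∈ l
    · obtain ⟨s, t, rfl⟩ := List.append_of_mem ha
      rw [List.map_append, List.prod_append, List.map_cons, List.prod_cons, ← mul_assoc,
        ← mul_assoc, hu.mul_mul_self, zero_mul]
    · rw [ih fun h => hl (h.cons ha), mul_zero]

theorem ncHsymm_mem_closure (hu : IsLamFamily u) (S : Finset α) (n : ℕ) :
    ncHsymm u S n ∈ Subring.closure (Set.range (ncEsymm u S)) := by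
  induction n using Nat.strong_induction_on with
  | _ n ih =>
  rcases n with _ | n
  · rw [ncHsymm_zero]
    exact one_mem _
  · have hmem : (-1) ^ (n + 1) * ncHsymm u S (n + 1) ∈
        Subring.closure (Set.range (ncEsymm u S)) := by
      have hsum := hu.sum_antidiagonal_ncHsymm_mul_ncEsymm S (n + 1)
      rw [Finset.Nat.sum_antidiagonal_succ', ncEsymm_zero, mul_one, if_neg n.succ_ne_zero] at hsum
      rw [eq_neg_of_add_eq_zero_left hsum]
      refine neg_mem (sum_mem fun ij hij => mul_mem (mul_mem (pow_mem (neg_mem (one_mem _)) _)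
        (ih _ ?_)) (Subring.subset_closure ⟨_, rfl⟩))
      have hle := Finset.HasAntidiagonal.antidiagonal.fst_le hij
      exact Nat.lt_succ_of_le hle
    have hpow : (-1) ^ (n + 1) ∈ Subring.closure (Set.range (ncEsymm u S)) :=
      pow_mem (neg_mem (one_mem _)) _
    have hmul := mul_mem hpow hmem
    rwa [← mul_assoc, ← pow_add, Even.neg_one_pow ⟨_, rfl⟩, one_mul] at hmul

open scoped IsMulCommutative in
theorem exists_isDualPair (hu : IsLamFamily u) (S : Finset α) :
    ∃ (C : Type w) (_ : CommRing C) (f : C →+* A) (E : ℤ → C) (H : ℕ → C), IsDualPair E H ∧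
      (∀ d : ℕ, f (E d) = ncEsymm u S d) ∧ ∀ d, f (H d) = ncHsymm u S d := by
  have hcomm : ∀ x ∈ Set.range (ncEsymm u S), ∀ y ∈ Set.range (ncEsymm u S), x * y = y * x := by
    rintro _ ⟨i, rfl⟩ _ ⟨j, rfl⟩
    exact hu.commute_ncEsymm S i j
  let C := Subring.closure (Set.range (ncEsymm u S))
  have : IsMulCommutative C := Subring.isMulCommutative_closure hcomm
  let E : ℤ → C
    | (d : ℕ) => ⟨ncEsymm u S d, Subring.subset_closure ⟨_, rfl⟩⟩
    | Int.negSucc _ => 0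
  let H : ℕ → C := fun d => ⟨ncHsymm u S d, hu.ncHsymm_mem_closure S d⟩
  refine ⟨C, inferInstance, C.subtype, E, H, ⟨?_, ?_, fun n => ?_⟩, fun _ => rfl, fun _ => rfl⟩
  · rintro (d | d) hd
    · exact absurd hd (by simp)
    · rfl
  · exact Subtype.ext (ncEsymm_zero u S)
  · refine C.subtype_injective ?_
    rw [map_sum, apply_ite C.subtype, map_one, map_zero,
      ← hu.sum_antidiagonal_ncHsymm_mul_ncEsymm S n]
    refine Finset.sum_congr rfl fun ij _ => ?_
    rw [map_mul, map_mul, map_pow, map_neg, map_one]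
    rfl

end CommutativeSubring

end IsLamFamily

section NoncommutativeSchur

variable {R : Type} [CommRing R] {N : ℕ} {A : Type*} [Ring A] {π : NCPoly R N →+* A}

theorem map_ncSchur {C : Type*} [CommRing C] {f : C →+* A} {E : ℤ → C}
    (hE : ∀ d, f (E d) = π (ncElem R N d)) (μ : YoungDiagram) :
    π (ncSchur R N μ) = f (dualJacobiTrudi E μ) := by
  rw [dualJacobiTrudi, ← Matrix.det_transpose, Matrix.det_apply, ncSchur, map_sum, map_sum]
  refine Finset.sum_congr rfl fun σ _ => ?_
  rw [map_zsmul, Units.smul_def, map_zsmul, map_list_prod, List.map_ofFn, ← List.prod_ofFn,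
    map_list_prod, List.map_ofFn]
  congr 3
  funext i
  exact (hE _).symm

theorem IsLamFamily.map_prod_ncHsymm (hπ : IsLamFamily fun a : Fin N => π (ncVar R a))
    {m : ℕ →₀ ℕ} {p : ℕ} (hm : ∀ i, p ≤ i → m i = 0) :
    π ((List.range p).map fun i => ncHsymm (ncVar R) Finset.univ (m i)).prod =
      π (∑ μ ∈ diagramsOfCard m.degree, (kostka μ m : R) • ncSchur R N μ) := by
  obtain ⟨C, _, f, E, H, hEH, hE, hH⟩ := hπ.exists_isDualPair Finset.univ
  have hE' : ∀ d, f (E d) = π (ncElem R N d) := by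
    intro d
    rcases lt_or_ge d 0 with hd | hd
    · rw [ncElem, if_pos hd, hEH.of_neg d hd, map_zero, map_zero]
    · lift d to ℕ using hd
      rw [hE, ncElem_natCast, map_ncEsymm]
  have hprod : π ((List.range p).map fun i => ncHsymm (ncVar R) Finset.univ (m i)).prod =
      f (∏ i ∈ Finset.range p, H (m i)) := by
    rw [map_list_prod, List.map_map, Finset.prod_range, ← List.prod_ofFn, map_list_prod,
      List.map_ofFn, List.ofFn_eq_map, ← List.map_coe_finRange_eq_range, List.map_map]
    congr 2
    funext i
    exact (map_ncHsymm _ _ _ _).trans (hH _).symm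
  rw [hprod, hEH.prod_range_eq_sum_kostka hm, map_sum, map_sum]
  refine Finset.sum_congr rfl fun μ _ => ?_
  rw [Nat.cast_smul_eq_nsmul, map_nsmul, map_ncSchur hE', map_mul, map_natCast, nsmul_eq_mul]

end NoncommutativeSchur

section SchurExpansion

variable {R : Type} [CommRing R] {N : ℕ} {I : TwoSidedIdeal (NCPoly R N)} {f : NCPoly R N}

theorem coeff_genFun (m : ℕ →₀ ℕ) : MvPowerSeries.coeff m (genFun R N f) =
    f.coeff.sum fun v a => a * MvPowerSeries.coeff m (wordQSym R v) := by
  rw [genFun, LinearMap.comp_apply, LinearEquiv.coe_coe, MonoidAlgebra.coeffLinearEquiv_apply,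
    Finsupp.linearCombination_apply, Finsupp.sum, map_sum]
  rfl

theorem genFun_monom (v : Word N) : genFun R N (monom R v) = wordQSym R v := by
  ext m
  rw [coeff_genFun, monom, MonoidAlgebra.of_apply, MonoidAlgebra.coeff_single,
    Finsupp.sum_single_index (zero_mul _), one_mul]

theorem nodup_of_coeff_ne_zero (hI : IsLamFamily fun a => I.ringCon.mk' (ncVar R a))
    (hf : f ∈ orthogonalComplement I) {v : Word N} (hv : f.coeff v ≠ 0) : v.toList.Nodup := by
  refine not_imp_comm.1 (fun hdup => ?_) hv
  have hmk : I.ringCon.mk' (monom R v) = I.ringCon.mk' 0 := by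
    rw [map_zero, ← hI.prod_map_eq_zero hdup, ← FreeMonoid.ofList_toList v, monom_ofList,
      map_list_prod, List.map_map]
    rfl
  rw [← wordPairing_monom, wordPairing_eq_of_mk'_eq hf hmk, map_zero, LinearMap.zero_apply]

theorem coeff_genFun_eq_sum_kostka (hI : IsLamFamily fun a => I.ringCon.mk' (ncVar R a))
    (hf : f ∈ orthogonalComplement I) (m : ℕ →₀ ℕ) :
    MvPowerSeries.coeff m (genFun R N f) =
      ∑ μ ∈ diagramsOfCard m.degree, (kostka μ m : R) * wordPairing R N (ncSchur R N μ) f := by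
  classical
  obtain ⟨p, hp⟩ := exists_forall_le_eq_zero m
  let h := ((List.range p).map fun i => ncHsymm (ncVar R) (Finset.univ : Finset (Fin N)) (m i)).prod
  calc MvPowerSeries.coeff m (genFun R N f)
      = f.coeff.sum fun v a => a * h.coeff v := by
        rw [coeff_genFun]
        refine Finsupp.sum_congr fun v hv => ?_
        rw [coeff_wordQSym_of_nodup R
          (nodup_of_coeff_ne_zero hI hf (Finsupp.mem_support_iff.1 hv)) hp,
          ← coeff_prod_ncHsymm, FreeMonoid.ofList_toList]
    _ = wordPairing R N h f := wordPairing_comm f h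
    _ = wordPairing R N
          (∑ μ ∈ diagramsOfCard m.degree, (kostka μ m : R) • ncSchur R N μ) f :=
        wordPairing_eq_of_mk'_eq hf (hI.map_prod_ncHsymm hp)
    _ = _ := by
        rw [map_sum, LinearMap.sum_apply]
        exact Finset.sum_congr rfl fun μ _ => by
          rw [map_smul, LinearMap.smul_apply, smul_eq_mul]

theorem exists_coeff_ne_zero_of_wordPairing_ne_zero {μ : YoungDiagram}
    (h : wordPairing R N (ncSchur R N μ) f ≠ 0) :
    ∃ v : Word N, f.coeff v ≠ 0 ∧ v.toList.length = μ.card := by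
  rw [wordPairing_comm, wordPairing, LinearMap.mk₂_apply] at h
  obtain ⟨v, _, hne⟩ := Finset.exists_ne_zero_of_sum_ne_zero h
  refine ⟨v, left_ne_zero_of_mul hne, ?_⟩
  exact_mod_cast not_imp_comm.1 (ncSchur_mem_homogeneousPart R μ v) (right_ne_zero_of_mul hne)

open scoped Classical in
/-- The pairings `⟨𝔍_μ(u), f⟩`, which are nonzero for finitely many `μ` only. -/
def schurPairings (f : NCPoly R N) : YoungDiagram →₀ R :=
  Finsupp.onFinset (f.coeff.support.biUnion fun v => diagramsOfCard v.toList.length)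
    (fun μ => wordPairing R N (ncSchur R N μ) f) fun μ hμ => by
      obtain ⟨v, hv, hlen⟩ := exists_coeff_ne_zero_of_wordPairing_ne_zero hμ
      exact Finset.mem_biUnion.2
        ⟨v, Finsupp.mem_support_iff.2 hv, mem_diagramsOfCard.2 hlen.symm⟩

theorem schurPairings_apply (f : NCPoly R N) (μ : YoungDiagram) :
    schurPairings f μ = wordPairing R N (ncSchur R N μ) f := rfl

theorem coeff_linearCombination_schurFun (c : YoungDiagram →₀ R) (m : ℕ →₀ ℕ) :
    MvPowerSeries.coeff m (Finsupp.linearCombination R (schurFun R) c) =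
      ∑ μ ∈ diagramsOfCard m.degree, (kostka μ m : R) * c μ := by
  classical
  rw [Finsupp.linearCombination_apply, Finsupp.sum_of_support_subset c
    (Finset.subset_union_left (s₂ := diagramsOfCard m.degree)) (fun μ a => a • schurFun R μ)
    fun _ _ => zero_smul R _, map_sum,
    ← Finset.sum_subset (Finset.subset_union_right (s₁ := c.support))]
  · exact Finset.sum_congr rfl fun μ _ => by
      rw [map_smul, coeff_schurFun, smul_eq_mul, mul_comm]
  · intro μ _ hμ
    rw [map_smul, coeff_schurFun, kostka_eq_zero_of_degree_ne fun h => hμ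
      (mem_diagramsOfCard.2 h.symm), Nat.cast_zero, smul_zero]

theorem genFun_eq_linearCombination_schurFun
    (hI : IsLamFamily fun a => I.ringCon.mk' (ncVar R a)) (hf : f ∈ orthogonalComplement I) :
    genFun R N f = Finsupp.linearCombination R (schurFun R) (schurPairings f) := by
  ext m
  simp only [coeff_genFun_eq_sum_kostka hI hf, coeff_linearCombination_schurFun,
    schurPairings_apply]

end SchurExpansion

/-! ### The quotient by Lam's relations -/

theorem commute_lie_of_mul_eq {A : Type*} [Ring A] {t a b m : A} (ht : IsUnit t)
    (hta : Commute t a) (htm : Commute t m) (hab : a * b = t * (b * a))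
    (hbm : b * m = t * (m * b)) : Commute ⁅a, m⁆ b := by
  have ham : a * m * b = b * (a * m) := ht.mul_left_cancel <| calc
    t * (a * m * b) = a * (t * (m * b)) := by rw [mul_assoc, hta.left_comm]
    _ = t * (b * (a * m)) := by rw [← hbm, ← mul_assoc, hab, mul_assoc, mul_assoc]
  have hma : m * a * b = b * (m * a) := calc
    m * a * b = t * (m * b) * a := by rw [mul_assoc, hab, htm.symm.left_comm]; simp only [mul_assoc]
    _ = b * (m * a) := by rw [← hbm, mul_assoc]
  rw [Ring.lie_def, Commute, SemiconjBy, sub_mul, mul_sub, ham, hma]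

section LamQuotient

variable {k N : ℕ}

theorem letter_lt_letter {a b : Fin N} (h : a < b) : letter a < letter b := by
  rw [Fin.lt_def] at h
  rw [letter, letter]
  lia

theorem qq_ne_zero : qq ≠ 0 := RatFunc.X_ne_zero

theorem mk'_lamIdeal_eq {x y : NCPoly QField N} (h : x - y ∈ lamRelations k N) :
    (lamIdeal k N).ringCon.mk' x = (lamIdeal k N).ringCon.mk' y :=
  (RingCon.eq _).2 (((lamIdeal k N).rel_iff x y).2 (TwoSidedIdeal.subset_span h))

theorem mk'_lamIdeal_mul_eq_of_near {a b : Fin N} (h : a < b) (hk : letter b - letter a < k) :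
    (lamIdeal k N).ringCon.mk' (uVar a) * (lamIdeal k N).ringCon.mk' (uVar b) =
      (lamIdeal k N).ringCon.mk' (algebraMap QField _ qq⁻¹) *
        ((lamIdeal k N).ringCon.mk' (uVar b) * (lamIdeal k N).ringCon.mk' (uVar a)) := by
  rw [← map_mul, ← map_mul, ← map_mul, ← Algebra.smul_def]
  exact mk'_lamIdeal_eq (Or.inl (Or.inr ⟨a, b, sub_pos.2 (letter_lt_letter h), hk, rfl⟩))

theorem mk'_lamIdeal_uVar_mul_mul_uVar (a : Fin N) (p : NCPoly QField N) :
    (lamIdeal k N).ringCon.mk' (uVar a * p * uVar a) = 0 := by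
  induction p using MonoidAlgebra.induction_on with
  | of w =>
    rw [← map_zero (lamIdeal k N).ringCon.mk']
    refine mk'_lamIdeal_eq (Or.inr ⟨FreeMonoid.of a * w * FreeMonoid.of a, ?_, ?_⟩)
    · simp [FreeMonoid.toList_mul]
    · rw [sub_zero, monom_mul, monom_mul]
      rfl
  | add p p' hp hp' => rw [mul_add, add_mul, map_add, hp, hp', add_zero]
  | smul r p hp => rw [mul_smul_comm, smul_mul_assoc, Algebra.smul_def, map_mul, hp, mul_zero]

theorem isLamFamily_mk'_lamIdeal :
    IsLamFamily fun a : Fin N => (lamIdeal k N).ringCon.mk' (ncVar QField a) where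
  mul_mul_self a p := by
    obtain ⟨p, rfl⟩ := RingCon.mk'_surjective _ p
    rw [← map_mul, ← map_mul]
    exact mk'_lamIdeal_uVar_mul_mul_uVar a p
  commute_lie a b m hab hbm := by
    have hab' := letter_lt_letter hab
    have hbm' := letter_lt_letter hbm
    by_cases hk : letter m - letter a > (k : ℤ)
    · have ham : Commute ((lamIdeal k N).ringCon.mk' (ncVar QField a))
          ((lamIdeal k N).ringCon.mk' (ncVar QField m)) := by
        rw [Commute, SemiconjBy, ← map_mul, ← map_mul]
        exact mk'_lamIdeal_eq (Or.inl (Or.inl ⟨a, m, hk, rfl⟩))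
      rw [commute_iff_lie_eq.1 ham]
      exact Commute.zero_left _
    · have hq : IsUnit (algebraMap QField (NCPoly QField N) qq⁻¹) :=
        (IsUnit.mk0 _ (inv_ne_zero qq_ne_zero)).map _
      exact commute_lie_of_mul_eq (hq.map _) ((Algebra.commute_algebraMap_left qq⁻¹ _).map _)
        ((Algebra.commute_algebraMap_left qq⁻¹ _).map _) (mk'_lamIdeal_mul_eq_of_near hab (by lia))
        (mk'_lamIdeal_mul_eq_of_near hbm (by lia))

end LamQuotient

/-! ### The LLT element -/

section PairSublist

open List (Sublist)

variable {α : Type*} {l l' : List α} {a b c d e : α}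

theorem pair_sublist_iff_get :
    Sublist [c, d] l ↔ ∃ p r : Fin l.length, p < r ∧ l.get p = c ∧ l.get r = d := by
  constructor
  · have h : l.Pairwise fun a b => ∃ p r : Fin l.length, p < r ∧ l.get p = a ∧ l.get r = b :=
      List.pairwise_iff_get.2 fun p r hpr => ⟨p, r, hpr, rfl, rfl⟩
    exact fun hs => List.pairwise_iff_forall_sublist.1 h hs
  · rintro ⟨p, r, hpr, rfl, rfl⟩
    have h : l.Pairwise fun a b => Sublist [a, b] l :=
      List.pairwise_iff_forall_sublist.2 fun hs => hs
    exact List.pairwise_iff_get.1 h p r hpr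

theorem not_pair_sublist_swap_of_nodup (hl : l.Nodup) (h : Sublist [c, d] l) :
    ¬ Sublist [d, c] l := by
  intro h'
  obtain ⟨p, r, hpr, rfl, rfl⟩ := pair_sublist_iff_get.1 h
  obtain ⟨r', p', hrp, hr, hp⟩ := pair_sublist_iff_get.1 h'
  rw [List.nodup_iff_injective_get.1 hl hr, List.nodup_iff_injective_get.1 hl hp] at hrp
  exact lt_asymm hpr hrp

theorem pair_sublist_cons : Sublist [c, d] (e :: l) ↔ Sublist [c, d] l ∨ c = e ∧ d ∈ l := by
  rw [List.cons_sublist_cons', List.singleton_sublist]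

theorem pair_sublist_append : Sublist [c, d] (l ++ l') ↔
    Sublist [c, d] l ∨ Sublist [c, d] l' ∨ c ∈ l ∧ d ∈ l' := by
  induction l with
  | nil => simp
  | cons e l ih =>
    rw [List.cons_append, pair_sublist_cons, pair_sublist_cons, ih, List.mem_append, List.mem_cons]
    tauto

theorem pair_sublist_append_cons_cons : Sublist [a, b] (l ++ a :: b :: l') :=
  pair_sublist_append.2 (Or.inr (Or.inl (pair_sublist_cons.2 (Or.inr ⟨rfl, List.mem_cons_self⟩))))

theorem pair_sublist_swap_iff (hab : ¬ (c = a ∧ d = b)) (hba : ¬ (c = b ∧ d = a)) :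
    Sublist [c, d] (l ++ a :: b :: l') ↔ Sublist [c, d] (l ++ b :: a :: l') := by
  simp only [pair_sublist_append, pair_sublist_cons, List.mem_cons]
  tauto

theorem append_swap_perm : (l ++ a :: b :: l').Perm (l ++ b :: a :: l') :=
  (List.Perm.swap b a l').append_left l

end PairSublist

section Inversions

variable {N : ℕ} (k : ℕ)

open scoped Classical in
/-- The pairs of letters that `kInv` counts. In contrast to the pairs of their positions, they can
be compared between a word and its rearrangements. -/
def kInvPairs (v : Word N) : Finset (Fin N × Fin N) :=
  {c | [c.1, c.2].Sublist v.toList ∧ 0 < letter c.1 - letter c.2 ∧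
    letter c.1 - letter c.2 < (k : ℤ)}

theorem mem_kInvPairs {v : Word N} {c d : Fin N} : (c, d) ∈ kInvPairs k v ↔
    [c, d].Sublist v.toList ∧ 0 < letter c - letter d ∧ letter c - letter d < (k : ℤ) := by
  rw [kInvPairs, Finset.mem_filter_univ]

theorem kInv_eq_card_kInvPairs {v : Word N} (hv : v.toList.Nodup) :
    kInv k v = (kInvPairs k v).card := by
  have hinj := List.nodup_iff_injective_get.1 hv
  refine Finset.card_bij (fun p _ => (v.toList.get p.1, v.toList.get p.2)) ?_ ?_ ?_
  · rintro ⟨p, r⟩ hp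
    obtain ⟨hpr, hnear⟩ := (Finset.mem_filter_univ _).1 hp
    exact (mem_kInvPairs k).2 ⟨pair_sublist_iff_get.2 ⟨p, r, hpr, rfl, rfl⟩, hnear⟩
  · rintro ⟨p, r⟩ _ ⟨p', r'⟩ _ h
    exact Prod.ext (hinj (Prod.mk_inj.1 h).1) (hinj (Prod.mk_inj.1 h).2)
  · rintro ⟨c, d⟩ hc
    obtain ⟨hsub, hnear⟩ := (mem_kInvPairs k).1 hc
    obtain ⟨p, r, hpr, rfl, rfl⟩ := pair_sublist_iff_get.1 hsub
    exact ⟨(p, r), (Finset.mem_filter_univ _).2 ⟨hpr, hnear⟩, rfl⟩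

variable {k} {x y : List (Fin N)} {a b : Fin N}

theorem kInv_swap_of_far (hv : (x ++ a :: b :: y).Nodup) (h : letter b - letter a > (k : ℤ)) :
    kInv k (FreeMonoid.ofList (x ++ a :: b :: y)) =
      kInv k (FreeMonoid.ofList (x ++ b :: a :: y)) := by
  rw [kInv_eq_card_kInvPairs k (v := FreeMonoid.ofList (x ++ a :: b :: y)) hv,
    kInv_eq_card_kInvPairs k (v := FreeMonoid.ofList (x ++ b :: a :: y))
      (append_swap_perm.nodup hv)]
  congr 1
  ext ⟨c, d⟩
  rw [mem_kInvPairs, mem_kInvPairs]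
  refine and_congr_left fun hcd => pair_sublist_swap_iff ?_ ?_
  · rintro ⟨rfl, rfl⟩
    lia
  · rintro ⟨rfl, rfl⟩
    lia

theorem kInvPairs_swap_of_near (h : 0 < letter b - letter a)
    (h' : letter b - letter a < (k : ℤ)) :
    kInvPairs k (FreeMonoid.ofList (x ++ b :: a :: y)) =
      insert (b, a) (kInvPairs k (FreeMonoid.ofList (x ++ a :: b :: y))) := by
  ext ⟨c, d⟩
  rw [Finset.mem_insert, mem_kInvPairs, mem_kInvPairs, Prod.mk_inj]
  by_cases hcd : c = b ∧ d = a
  · obtain ⟨rfl, rfl⟩ := hcd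
    exact ⟨fun _ => Or.inl ⟨rfl, rfl⟩, fun _ => ⟨pair_sublist_append_cons_cons, h, h'⟩⟩
  · rw [or_iff_right hcd]
    refine and_congr_left fun hnear => pair_sublist_swap_iff hcd ?_
    rintro ⟨rfl, rfl⟩
    lia

theorem kInv_swap_of_near (hv : (x ++ a :: b :: y).Nodup) (h : 0 < letter b - letter a)
    (h' : letter b - letter a < (k : ℤ)) :
    kInv k (FreeMonoid.ofList (x ++ b :: a :: y)) =
      kInv k (FreeMonoid.ofList (x ++ a :: b :: y)) + 1 := by
  rw [kInv_eq_card_kInvPairs k (v := FreeMonoid.ofList (x ++ a :: b :: y)) hv,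
    kInv_eq_card_kInvPairs k (v := FreeMonoid.ofList (x ++ b :: a :: y))
      (append_swap_perm.nodup hv),
    kInvPairs_swap_of_near h h', Finset.card_insert_of_notMem]
  intro hba
  exact not_pair_sublist_swap_of_nodup hv ((mem_kInvPairs k).1 hba).1 pair_sublist_append_cons_cons

end Inversions

section LLTWords

variable {N k : ℕ} {β : Fin k → SkewShapeWithContents}

theorem occursBefore_iff_exists_pair_sublist {v : Word N} {s t : ℤ} : OccursBefore v s t ↔
    ∃ c d : Fin N, letter c = s ∧ letter d = t ∧ [c, d].Sublist v.toList := by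
  constructor
  · rintro ⟨p, r, hpr, rfl, rfl⟩
    exact ⟨_, _, rfl, rfl, pair_sublist_iff_get.2 ⟨p, r, hpr, rfl, rfl⟩⟩
  · rintro ⟨c, d, rfl, rfl, h⟩
    obtain ⟨p, r, hpr, rfl, rfl⟩ := pair_sublist_iff_get.1 h
    exact ⟨p, r, hpr, rfl, rfl⟩

theorem snd_eq_of_mem_neighbours {b : SkewShapeWithContents} {p : ℤ × ℤ} (hp : p ∈ b.neighbours) :
    p.2 = p.1 + 1 ∨ p.2 = p.1 - 1 := by
  induction b using Quotient.inductionOn with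
  | h s =>
    obtain ⟨z, -, z', -, hzz, rfl⟩ : p ∈ s.neighbours := hp
    simp only [SkewShape.East, SkewShape.South, SkewShape.content] at hzz ⊢
    lia

theorem shifted_sub_shifted_of_mem_neighbours {b : SkewShapeWithContents} {p : ℤ × ℤ}
    (hp : p ∈ b.neighbours) (i : Fin k) :
    shifted k i p.2 - shifted k i p.1 = k ∨ shifted k i p.1 - shifted k i p.2 = k := by
  rw [shifted, shifted]
  rcases snd_eq_of_mem_neighbours hp with h | h
  · exact Or.inl (by rw [h]; ring)
  · exact Or.inr (by rw [h]; ring)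

theorem swap_mem_lltWordSet {x y : List (Fin N)} {a b : Fin N}
    (hba : letter b - letter a ≠ k) (hab : letter a - letter b ≠ k)
    (hv : FreeMonoid.ofList (x ++ a :: b :: y) ∈ lltWordSet N β) :
    FreeMonoid.ofList (x ++ b :: a :: y) ∈ lltWordSet N β := by
  obtain ⟨hnodup, hcontents, horder⟩ := hv
  refine ⟨append_swap_perm.nodup hnodup, hcontents ▸
    Multiset.coe_eq_coe.2 (append_swap_perm.map letter), fun i p hp => ?_⟩
  obtain ⟨c, d, hc, hd, hcd⟩ := occursBefore_iff_exists_pair_sublist.1 (horder i p hp)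
  refine occursBefore_iff_exists_pair_sublist.2 ⟨c, d, hc, hd, ?_⟩
  have hdiff := shifted_sub_shifted_of_mem_neighbours hp i
  rw [← hc, ← hd] at hdiff
  refine (pair_sublist_swap_iff ?_ ?_).1 hcd
  · rintro ⟨rfl, rfl⟩
    tauto
  · rintro ⟨rfl, rfl⟩
    tauto

theorem swap_mem_lltWordSet_iff {x y : List (Fin N)} {a b : Fin N}
    (hba : letter b - letter a ≠ k) (hab : letter a - letter b ≠ k) :
    FreeMonoid.ofList (x ++ b :: a :: y) ∈ lltWordSet N β ↔
      FreeMonoid.ofList (x ++ a :: b :: y) ∈ lltWordSet N β :=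
  ⟨swap_mem_lltWordSet hab hba, swap_mem_lltWordSet hba hab⟩

end LLTWords

section LLTElement

variable {N k : ℕ} (β : Fin k → SkewShapeWithContents) {x y : List (Fin N)} {a b : Fin N}

open scoped Classical in
theorem coeff_lltElement (v : Word N) :
    (lltElement N β).coeff v = if v ∈ lltWordSet N β then qq ^ kInv k v else 0 := by
  rw [lltElement, MonoidAlgebra.coeff_sum, Finsupp.finsetSum_apply]
  simp only [MonoidAlgebra.coeff_smul, Finsupp.smul_apply, coeff_monom, smul_eq_mul, mul_ite,
    mul_one, mul_zero]
  rw [Finset.sum_ite_eq' (lltWords N β) v fun w => qq ^ kInv k w]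
  simp only [lltWords, Set.Finite.mem_toFinset]

theorem coeff_lltElement_of_not_nodup {v : Word N} (h : ¬ v.toList.Nodup) :
    (lltElement N β).coeff v = 0 := by
  rw [coeff_lltElement, if_neg fun hv => h hv.1]

theorem coeff_lltElement_swap_of_far (h : letter b - letter a > (k : ℤ)) :
    (lltElement N β).coeff (FreeMonoid.ofList (x ++ a :: b :: y)) =
      (lltElement N β).coeff (FreeMonoid.ofList (x ++ b :: a :: y)) := by
  rw [coeff_lltElement, coeff_lltElement,
    swap_mem_lltWordSet_iff (a := a) (b := b) (by lia) (by lia)]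
  split_ifs with hv
  · rw [kInv_swap_of_far hv.1 h]
  · rfl

theorem coeff_lltElement_swap_of_near (h : 0 < letter b - letter a)
    (h' : letter b - letter a < (k : ℤ)) :
    (lltElement N β).coeff (FreeMonoid.ofList (x ++ a :: b :: y)) =
      qq⁻¹ * (lltElement N β).coeff (FreeMonoid.ofList (x ++ b :: a :: y)) := by
  rw [coeff_lltElement, coeff_lltElement,
    swap_mem_lltWordSet_iff (a := a) (b := b) (by lia) (by lia)]
  split_ifs with hv
  · rw [kInv_swap_of_near hv.1 h h', pow_succ', inv_mul_cancel_left₀ qq_ne_zero]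
  · rw [mul_zero]

theorem wordPairing_monom_mul_uVar_mul_uVar_mul_monom (v w : Word N) (f : NCPoly QField N) :
    wordPairing QField N (monom QField v * (uVar a * uVar b) * monom QField w) f =
      f.coeff (FreeMonoid.ofList (v.toList ++ a :: b :: w.toList)) := by
  rw [uVar, uVar, ← monom_mul, ← monom_mul, ← monom_mul, wordPairing_monom, mul_assoc]
  rfl

theorem lltElement_mem_orthogonalComplement :
    lltElement N β ∈ orthogonalComplement (lamIdeal k N) := by
  refine mem_orthogonalComplement_span fun z hz v w => ?_
  rcases hz with (⟨a, c, h, rfl⟩ | ⟨a, b, h, h', rfl⟩) | ⟨r, hr, rfl⟩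
  · rw [mul_sub, sub_mul, map_sub, LinearMap.sub_apply,
      wordPairing_monom_mul_uVar_mul_uVar_mul_monom, wordPairing_monom_mul_uVar_mul_uVar_mul_monom,
      coeff_lltElement_swap_of_far β h, sub_self]
  · rw [mul_sub, sub_mul, mul_smul_comm, smul_mul_assoc, map_sub, map_smul, LinearMap.sub_apply,
      LinearMap.smul_apply, wordPairing_monom_mul_uVar_mul_uVar_mul_monom,
      wordPairing_monom_mul_uVar_mul_uVar_mul_monom, coeff_lltElement_swap_of_near β h h',
      smul_eq_mul, sub_self]
  · rw [← monom_mul, ← monom_mul, wordPairing_monom]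
    refine coeff_lltElement_of_not_nodup β fun hnodup => hr (hnodup.sublist ?_)
    rw [FreeMonoid.toList_mul, FreeMonoid.toList_mul]
    exact (List.sublist_append_right _ _).trans (List.sublist_append_left _ _)

theorem genFun_lltElement : genFun QField N (lltElement N β) = lltPoly N β := by
  simp only [lltElement, lltPoly, map_sum, map_smul, genFun_monom]

end LLTElement

end

theorem propositionp (k N : ℕ) (β : Fin k → SkewShapeWithContents) (hβ : Admissible N β) :
    lltElement N β ∈ orthogonalComplement (lamIdeal k N) ∧
    lltPoly N β = genFun QField N (lltElement N β) ∧
    (∃! c : YoungDiagram →₀ QField, IsQLRFamily N β c) ∧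
    ∀ c : YoungDiagram →₀ QField, IsQLRFamily N β c →
      ∀ lam : YoungDiagram, c lam = wordPairing QField N (ncSchur QField N lam) (lltElement N β) := by
  have hmem := lltElement_mem_orthogonalComplement (N := N) β
  have hexpand : IsQLRFamily N β (schurPairings (lltElement N β)) := by
    rw [IsQLRFamily, ← genFun_lltElement,
      genFun_eq_linearCombination_schurFun isLamFamily_mk'_lamIdeal hmem,
      Finsupp.linearCombination_apply]
  have hunique : ∀ c, IsQLRFamily N β c → c = schurPairings (lltElement N β) := fun c hc =>
    linearIndependent_schurFun QField (hc.symm.trans hexpand)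
  exact ⟨hmem, (genFun_lltElement β).symm, ⟨_, hexpand, hunique⟩,
    fun c hc lam => by rw [hunique c hc, schurPairings_apply]⟩
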